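/- Let $\mathcal H\neq\{0\}$ be a separable real Hilbert space (of finite or countably infinite dimension), and let $\mathcal D$ be a probability distribution of pairs $(x,y)\in\mathcal H\times\mathbb R$ with $\mathbb E\|x\|^2<\infty$, $\mathbb E\|x\|^4<\infty$ and $\mathbb E[y^2]<\infty$. Put $L(w)=\tfrac12\,\mathbb E_{(x,y)\sim\mathcal D}\big[(y-\langle w,x\rangle)^2\big]$ and $H=\mathbb E[xx^\top]$. Suppose that $H$ is strictly positive definite and that $L$ has a unique global minimizer $w^*$. Let $H=\sum_{i\ge1}\lambda_i v_iv_i^\top$ be an eigendecomposition of $H$, with $(v_i)$ an orthonormal basis of $\mathcal H$ and $\lambda_1\ge\lambda_2\ge\cdots$. Suppose that 1. (well-specified model) $y=\langle w^*,x\rangle+\epsilon$ with $\epsilon\sim\mathcal N(0,\sigma^2_{\mathrm{noise}})$ independent of $x$, where $\sigma^2_{\mathrm{noise}}\ge 0$; 2. (fourth moment lower bound) $\beta\ge0$ is a constant such that $\mathbb E[xx^\top Axx^\top]-HAH\succeq\beta\,\mathrm{tr}(HA)\,H$ for every positive semidefinite bounded operator $A$ on $\mathcal H$. Let $N\ge500$,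 $0<\gamma<1/\lambda_1$ and $w_0\in\mathcal H$. Let $(x_1,y_1),\dots,(x_N,y_N)$ be i.i.d. samples from $\mathcal D$, let $w_t=w_{t-1}+\gamma\,(y_t-\langle w_{t-1},x_t\rangle)\,x_t$ for $t=1,\dots,N$, and let $\overline w_N=\frac1N\sum_{t=0}^{N-1}w_t$. Let $k^*=\max\{k\ge 1:\lambda_k\ge\frac1{N\gamma}\}$, with $k^*=0$ if there is no such $k$. Then $L(\overline w_N)$ is integrable and $$ \begin{aligned} \mathbb E[L(\overline w_N)]-L(w^*)\ \ge\ &\frac1{16\gamma^2N^2}\,\|w_0-w^*\|^2_{H_{0:k^*}^{-1}}+\frac1{16}\,\|w_0-w^*\|^2_{H_{k^*:\infty}}\\ &+\frac{\beta\gamma\,\|w_0-w^*\|_H^2}{128e^3}\cdot\min\Big\{\frac1{\lambda_1},N\gamma\Big\}\cdot\sum_{i>k^*}\lambda_i^2\\ &+\frac{\sigma^2_{\mathrm{noise}}}{50}\Big(\frac{k^*}N+N\gamma^2\sum_{i>k^*}\lambda_i^2\Big), \end{aligned} $$ where $\|w\|_H^2=\langle w,Hw\rangle$, $\|w\|^2_{H_{0:k}^{-1}}=\sum_{i\le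 k}\langle v_i,w\rangle^2/\lambda_i$ and $\|w\|^2_{H_{k:\infty}}=\sum_{i>k}\lambda_i\langle v_i,w\rangle^2$. -/

import Mathlib

open MeasureTheory ProbabilityTheory
open scoped NNReal ENNReal

namespace AvgSGD

noncomputable section

variable {E : Type*} [NormedAddCommGroup E] [InnerProductSpace ℝ E]

/-- The index set of an orthonormal basis of a `d`-dimensional space, `d ≤ ∞`. The index `i` here is
the index `i + 1` in the usual enumeration `1, 2, …`. -/
abbrev Idx (d : ℕ∞) : Type := {i : ℕ // (i : ℕ∞) < d}

/-- The operator `x xᵀ : u ↦ ⟪x, u⟫ x`. -/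
def outer (x : E) : E →L[ℝ] E := InnerProductSpace.rankOne ℝ x x

/-- The least squares risk `L(w) = ½ 𝔼_{(x, y) ∼ D} (y - ⟪w, x⟫)²`. -/
def risk [MeasurableSpace E] (D : Measure (E × ℝ)) (w : E) : ℝ :=
  (1 / 2) * ∫ p, (p.2 - inner ℝ w p.1) ^ 2 ∂D

/-- The second moment operator `H = 𝔼[x xᵀ]`, as a Bochner integral of operators. -/
def secondMoment [MeasurableSpace E] (D : Measure (E × ℝ)) : E →L[ℝ] E :=
  ∫ p, outer p.1 ∂D

/-- The fourth moment operator applied to `A`, that is `𝔼[x xᵀ A x xᵀ]`. -/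
def fourthMoment [MeasurableSpace E] (D : Measure (E × ℝ)) (A : E →L[ℝ] E) : E →L[ℝ] E :=
  ∫ p, outer p.1 ∘L A ∘L outer p.1 ∂D

/-- The trace of an operator, computed in the orthonormal basis `b`. -/
def traceIn {ι : Type*} (b : HilbertBasis ι ℝ E) (T : E →L[ℝ] E) : ℝ :=
  ∑' i, inner ℝ (b i) (T (b i))

/-- The regularity conditions: the second and fourth moments of `x` and the second moment of `y` are
finite (so the integrals above converge and `H` has finite trace), `H` is strictly positive
definite, and `wstar` is the unique global minimizer of the risk. -/
structure Regularity [MeasurableSpace E] (D : Measure (E × ℝ)) (wstar : E) : Prop where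
  integrable_sq : Integrable (fun p : E × ℝ => ‖p.1‖ ^ 2) D
  integrable_fourth : Integrable (fun p : E × ℝ => ‖p.1‖ ^ 4) D
  integrable_label_sq : Integrable (fun p : E × ℝ => p.2 ^ 2) D
  posDef : ∀ u : E, u ≠ 0 → 0 < inner ℝ u (secondMoment D u)
  unique_min : ∀ w : E, w ≠ wstar → risk D wstar < risk D w

/-- Well-specified model: `y = ⟪wstar, x⟫ + ε`, where `ε ∼ 𝒩(0, s2)` is independent of `x`. -/
structure WellSpecified [MeasurableSpace E] (D : Measure (E × ℝ)) (wstar : E) (s2 : ℝ≥0) :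
    Prop where
  noise_law : HasLaw (fun p : E × ℝ => p.2 - inner ℝ wstar p.1) (gaussianReal 0 s2) D
  noise_indep : IndepFun (fun p : E × ℝ => p.1) (fun p : E × ℝ => p.2 - inner ℝ wstar p.1) D

/-- The lower bound on the fourth moment with constant `β`, in the Loewner order:
`𝔼[x xᵀ A x xᵀ] - H A H ⪰ β tr(H A) H` for every positive semidefinite bounded operator `A`. -/
def FourthMomentLowerBound [MeasurableSpace E] {ι : Type*} (D : Measure (E × ℝ))
    (b : HilbertBasis ι ℝ E) (β : ℝ) : Prop :=
  ∀ A : E →L[ℝ] E, A.IsPositive →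
    (β * traceIn b (secondMoment D ∘L A)) • secondMoment D
      ≤ fourthMoment D A - secondMoment D ∘L A ∘L secondMoment D

/-- An eigendecomposition of `T`: `v` is an orthonormal basis of eigenvectors, with eigenvalues
`lam` in non-increasing order and repeated with multiplicity. -/
structure IsEigendecomposition {d : ℕ∞} (T : E →L[ℝ] E) (lam : Idx d → ℝ)
    (v : HilbertBasis (Idx d) ℝ E) : Prop where
  antitone : Antitone lam
  apply_eq : ∀ i, T (v i) = lam i • v i

/-- The iterates of constant stepsize SGD on the samples `z`:
`w_{t+1} = w_t + γ (y_{t+1} - ⟪w_t, x_{t+1}⟫) x_{t+1}`, where `(x_{t+1}, y_{t+1}) = z t`. -/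
def sgd (γ : ℝ) (w₀ : E) (z : ℕ → E × ℝ) : ℕ → E
  | 0 => w₀
  | t + 1 => sgd γ w₀ z t + (γ * ((z t).2 - inner ℝ (sgd γ w₀ z t) (z t).1)) • (z t).1

/-- The average `(1 / N) ∑_{t = 0}^{N - 1} w_t` of the iterates. -/
def avgIterate (γ : ℝ) (w₀ : E) (z : ℕ → E × ℝ) (N : ℕ) : E :=
  (N : ℝ)⁻¹ • ∑ t ∈ Finset.range N, sgd γ w₀ z t

/-- The effective dimension `max {k : λ_k ≥ 1 / (N γ)}` with `k` counted from `1`; it is `0` when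
there is no such `k`. -/
def effDim {d : ℕ∞} (lam : Idx d → ℝ) (N : ℕ) (γ : ℝ) : ℕ :=
  sSup {k : ℕ | ∃ i : Idx d, k = i.1 + 1 ∧ 1 / (N * γ) ≤ lam i}

/-- `‖w‖²_{H_{0:k}⁻¹} = ∑_{i ≤ k} (v_iᵀ w)² / λ_i`. -/
def headNormSq {d : ℕ∞} (lam : Idx d → ℝ) (v : HilbertBasis (Idx d) ℝ E) (k : ℕ) (w : E) : ℝ :=
  ∑' i : Idx d, if i.1 < k then inner ℝ (v i) w ^ 2 / lam i else 0

/-- `‖w‖²_{H_{k:∞}} = ∑_{i > k} λ_i (v_iᵀ w)²`. -/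
def tailNormSq {d : ℕ∞} (lam : Idx d → ℝ) (v : HilbertBasis (Idx d) ℝ E) (k : ℕ) (w : E) : ℝ :=
  ∑' i : Idx d, if k ≤ i.1 then lam i * inner ℝ (v i) w ^ 2 else 0

/-- `∑_{i > k} λ_i²`. -/
def tailSumSq {d : ℕ∞} (lam : Idx d → ℝ) (k : ℕ) : ℝ :=
  ∑' i : Idx d, if k ≤ i.1 then lam i ^ 2 else 0

end

end AvgSGD

set_option linter.unusedSectionVars false

namespace AvgSGD

/-! ### Elementary estimates for powers and geometric sums -/

/-! Write `η_t = w_t - w*` and `S_t = ∑_{r<t} η_r`. In the well-specified model the risk is exactly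
quadratic, so the excess risk of the average is `𝔼⟪S_N, H S_N⟫ / (2N²)`, which splits over the
eigenvectors of `H`. In a fixed direction `v` with eigenvalue `l`, put `q = 1 - γl` and follow three
scalars: `a_t = 𝔼⟪v, η_t⟫²`, `b_t = 𝔼⟪v, S_t⟫²` and `c_t = 𝔼⟪v, S_t⟫⟪v, η_t⟫`.

The sample used at step `t` is independent of the past, and averaging over it multiplies the mean of
`⟪v, η_t⟫` by `q`. This gives exact recursions for `b` and `c`, from which `(1 - q) b_N ≥ ∑_{t<N} (1
- q^(N-t)) a_t` (`sum_le_of_recursion`). The fourth moment condition with `A = η_t η_tᵀ` gives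
`a_{t+1} ≥ q² a_t + γ² l (β 𝔼⟪η_t, H η_t⟫ + σ²)` (`iterateMoment_succ_ge`). Feeding this back,
`𝔼⟪η_t, H η_t⟫` decays no faster than `(1 - γλ₁)^(2t)` (`pow_mul_le_riskMoment`).

Unrolling bounds `a_t` below by a bias term, a `β` term and a label noise term (`weighted_sum_ge`).
What remains is to estimate three explicit sums in `x = γl`, according to whether `N x ≥ 1` (the
head, `head_coordinate_le`) or `N x ≤ 1` (the tail, `tail_coordinate_le`), and to add up the
directions in `lower_bound_le`. -/

theorem one_sub_pow_le {x : ℝ} (hx0 : 0 ≤ x) (hx1 : x ≤ 1) (k : ℕ) :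
    (1 - x) ^ k ≤ 1 - k * x + (k * x) ^ 2 / 2 := by
  induction k with
  | zero => simp
  | succ k ih =>
    have h := mul_le_mul_of_nonneg_left ih (sub_nonneg.2 hx1)
    rw [pow_succ']
    push_cast
    have h3 : 0 ≤ (k : ℝ) ^ 2 * x ^ 3 := by positivity
    nlinarith [sq_nonneg x]

/-- `1 - (1 - x)^k ≥ min(1, k x) / 2`. -/
theorem half_min_le_one_sub_pow {x : ℝ} (hx0 : 0 ≤ x) (hx1 : x ≤ 1) (k : ℕ) :
    min 1 (k * x) / 2 ≤ 1 - (1 - x) ^ k := by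
  rcases le_total (k * x) 1 with h | h
  · rw [min_eq_right h]
    have h1 := one_sub_pow_le hx0 hx1 k
    have h2 : 0 ≤ k * x := by positivity
    nlinarith
  · rw [min_eq_left h]
    have hk : (0 : ℝ) < k := by
      rcases Nat.eq_zero_or_pos k with rfl | hk
      · norm_num at h
      · exact_mod_cast hk
    -- By monotonicity in `x` it suffices to treat `x = 1/k`, the vertex of the quadratic bound,
    -- where its value is `1/2`.
    have hk1 : (k : ℝ)⁻¹ ≤ x := by
      rw [inv_le_iff_one_le_mul₀' hk]; exact h
    have h1 := one_sub_pow_le (inv_nonneg.2 hk.le) (hk1.trans hx1) k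
    have h2 : (1 - x) ^ k ≤ (1 - (k : ℝ)⁻¹) ^ k :=
      pow_le_pow_left₀ (by linarith) (by linarith) k
    rw [mul_inv_cancel₀ hk.ne'] at h1
    linarith

theorem sum_range_mul_sub (N : ℕ) (M : ℝ) :
    ∑ t ∈ Finset.range N, (t : ℝ) * (M - t)
      = M * (N * (N - 1) / 2) - (N - 1) * N * (2 * N - 1) / 6 := by
  induction N with
  | zero => simp
  | succ n ih => rw [Finset.sum_range_succ, ih]; push_cast; ring

theorem sum_range_mul_sub_self (N : ℕ) :
    ∑ t ∈ Finset.range N, (t : ℝ) * (N - t) = N * ((N : ℝ) ^ 2 - 1) / 6 := by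
  rw [sum_range_mul_sub]; ring

theorem one_sub_mul_geom_sum_sq (q : ℝ) (t : ℕ) :
    (1 - q) * (1 + q) * ∑ s ∈ Finset.range t, q ^ (2 * s) = 1 - q ^ (2 * t) := by
  have h := mul_neg_geom_sum (q ^ 2) t
  simp only [← pow_mul] at h
  rw [← h]; ring

/-- With `u = q^N` the sum is a difference of two geometric sums, and multiplying it by `(1 - q)(1 +
q)` gives exactly `(1 - u)(1 - q u) ≥ (1 - u)²`. The factor 2 comes from `1 + q ≤ 2`. -/
theorem sum_bias_ge {x : ℝ} (hx0 : 0 < x) (hx1 : x < 1) (N : ℕ) :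
    (1 - (1 - x) ^ N) ^ 2 / (2 * x)
      ≤ ∑ t ∈ Finset.range N, (1 - (1 - x) ^ (N - t)) * (1 - x) ^ (2 * t) := by
  set q := 1 - x with hq
  have hsum : ∑ t ∈ Finset.range N, (1 - q ^ (N - t)) * q ^ (2 * t)
      = ∑ t ∈ Finset.range N, q ^ (2 * t) - q ^ N * ∑ t ∈ Finset.range N, q ^ t := by
    rw [Finset.mul_sum, ← Finset.sum_sub_distrib]
    refine Finset.sum_congr rfl fun t ht => ?_
    have : t < N := Finset.mem_range.1 ht
    rw [sub_mul, one_mul, ← pow_add, ← pow_add]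
    congr 2
    omega
  have h1 := one_sub_mul_geom_sum_sq q N
  have h2 := mul_neg_geom_sum q N
  have hxq : x = 1 - q := by rw [hq]; ring
  have hq0 : 0 < q := by linarith
  have hq1 : q < 1 := by linarith
  have hN1 : q ^ N ≤ 1 := pow_le_one₀ hq0.le hq1.le
  have hN0 : 0 ≤ q ^ N := by positivity
  rw [hsum, div_le_iff₀ (by linarith), hxq]
  set A := ∑ t ∈ Finset.range N, q ^ (2 * t)
  set B := ∑ t ∈ Finset.range N, q ^ t
  set u := q ^ N
  have h1' : (1 - q) * (1 + q) * A = 1 - u ^ 2 := by rw [h1, ← pow_mul, mul_comm]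
  have hX : (1 + q) * ((A - u * B) * (1 - q)) = (1 - u) * (1 - q * u) := by
    linear_combination h1' - (1 + q) * u * h2
  have hpos : 0 ≤ (A - u * B) * (1 - q) := by
    have : 0 ≤ (1 + q) * ((A - u * B) * (1 - q)) := by
      rw [hX]; exact mul_nonneg (by linarith) (by nlinarith)
    exact nonneg_of_mul_nonneg_right this (by linarith)
  nlinarith [mul_nonneg (sub_nonneg.2 hN1) (mul_nonneg hN0 (sub_nonneg.2 hq1.le))]

/-- Up to second order each factor is linear: with `α = t x`, `δ = (N - t) x` and `α + δ ≤ 1`, the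
product is at least `αδ(1 - α/2)(1 - δ/2) ≥ αδ/2`. Summing gives `x² N (N² - 1) / 12`, and `(N² -
1)/12 ≥ 2N²/25` is equivalent to `N ≥ 5`. -/
theorem sum_variance_ge_of_mul_le_one {x : ℝ} (hx0 : 0 ≤ x) (hx1 : x ≤ 1) {N : ℕ}
    (hN : 5 ≤ N) (hNx : N * x ≤ 1) :
    2 / 25 * (N : ℝ) ^ 3 * x ^ 2
      ≤ ∑ t ∈ Finset.range N, (1 - (1 - x) ^ (N - t)) * (1 - (1 - x) ^ t) := by
  have key : ∀ t ∈ Finset.range N, x ^ 2 / 2 * ((t : ℝ) * (N - t))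
      ≤ (1 - (1 - x) ^ (N - t)) * (1 - (1 - x) ^ t) := by
    intro t ht
    have htN : t < N := Finset.mem_range.1 ht
    have h1 := one_sub_pow_le hx0 hx1 t
    have h2 := one_sub_pow_le hx0 hx1 (N - t)
    rw [Nat.cast_sub htN.le] at h2
    have htN' : (t : ℝ) ≤ N := by exact_mod_cast htN.le
    set α := (t : ℝ) * x
    set δ := ((N : ℝ) - t) * x
    have hα : 0 ≤ α := by positivity
    have hδ : 0 ≤ δ := mul_nonneg (by linarith) hx0
    have hs : α + δ ≤ 1 := by
      have : α + δ = N * x := by simp only [α, δ]; ring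
      linarith
    calc x ^ 2 / 2 * ((t : ℝ) * (N - t)) = δ * α / 2 := by simp only [α, δ]; ring
      _ ≤ (δ - δ ^ 2 / 2) * (α - α ^ 2 / 2) := by
        have : 0 ≤ α * δ := mul_nonneg hα hδ
        nlinarith [mul_nonneg this this, mul_nonneg this (sub_nonneg.2 hs)]
      _ ≤ _ := mul_le_mul (by linarith) (by linarith) (by nlinarith) (by nlinarith)
  refine le_trans ?_ (Finset.sum_le_sum key)
  rw [← Finset.mul_sum, sum_range_mul_sub_self]
  have hN' : (5 : ℝ) ≤ N := by exact_mod_cast hN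
  have : 0 ≤ x ^ 2 * (N * ((N : ℝ) ^ 2 - 25)) :=
    mul_nonneg (sq_nonneg x) (mul_nonneg (by linarith) (by nlinarith))
  nlinarith

/-- Every summand is nondecreasing in `x`, so the case `x = 1/N` of the preceding bound suffices. -/
theorem sum_variance_ge_of_one_le_mul {x : ℝ} (hx1 : x ≤ 1) {N : ℕ}
    (hN : 5 ≤ N) (hNx : 1 ≤ N * x) :
    2 / 25 * (N : ℝ)
      ≤ ∑ t ∈ Finset.range N, (1 - (1 - x) ^ (N - t)) * (1 - (1 - x) ^ t) := by
  have hN0 : (0 : ℝ) < N := by exact_mod_cast (by omega : 0 < N)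
  have hle : (N : ℝ)⁻¹ ≤ x := by rw [inv_le_iff_one_le_mul₀' hN0]; exact hNx
  have h0 : (0 : ℝ) ≤ (N : ℝ)⁻¹ := inv_nonneg.2 hN0.le
  have h := sum_variance_ge_of_mul_le_one h0 (hle.trans hx1) hN
    (mul_inv_cancel₀ hN0.ne').le
  refine le_trans (le_of_eq ?_) (h.trans (Finset.sum_le_sum fun t _ => ?_))
  · field_simp
  · have hm : ∀ k : ℕ, (1 - x) ^ k ≤ (1 - (N : ℝ)⁻¹) ^ k := fun k =>
      pow_le_pow_left₀ (by linarith) (by linarith) k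
    have hp : ∀ k : ℕ, (1 - (N : ℝ)⁻¹) ^ k ≤ 1 := fun k =>
      pow_le_one₀ (by linarith) (by linarith)
    exact mul_le_mul (by linarith [hm (N - t)]) (by linarith [hm t]) (by linarith [hp t])
      (by linarith [hm (N - t), hp (N - t)])

/-- The bound `1 - x ≥ exp(-3x/2)` holds on `[0, 1/3]` because `(1 + 3x/2)(1 - x) ≥ 1` there. -/
theorem exp_neg_three_le {x : ℝ} (hx0 : 0 ≤ x) (hx1 : x ≤ 1 / 3) {N : ℕ} (hNx : N * x ≤ 1) :
    Real.exp (-3) ≤ (1 - x) ^ (2 * N) := by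
  have h1 : Real.exp (-(3 / 2 * x)) ≤ 1 - x := by
    have h2 : (1 - x)⁻¹ ≤ Real.exp (3 / 2 * x) := by
      refine le_trans ?_ (Real.add_one_le_exp _)
      rw [inv_le_iff_one_le_mul₀ (by linarith)]
      nlinarith
    rw [Real.exp_neg]
    exact inv_le_of_inv_le₀ (by linarith) h2
  calc Real.exp (-3) ≤ Real.exp ((2 * N : ℕ) * (-(3 / 2 * x))) := by
        apply Real.exp_le_exp.2; push_cast; nlinarith
    _ = Real.exp (-(3 / 2 * x)) ^ (2 * N) := Real.exp_nat_mul _ _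
    _ ≤ _ := pow_le_pow_left₀ (Real.exp_pos _).le h1 _

/-- Since `N x ≤ 1`, the powers of `1 - x` in the inner sum cost at most `e⁻³`. The remaining
geometric sum in `1 - x₁` is at least of order `min(1/x₁, t)`, weakened to the linear form `(t/N)
min(1/x₁, N) / 4` so that the outer sum becomes `∑ t (N - t)`. -/
theorem sum_noise_ge {x x₁ : ℝ} (hx0 : 0 < x) (hx₁ : x ≤ x₁) (hx₁' : x₁ < 1) {N : ℕ}
    (hN : 3 ≤ N) (hNx : N * x ≤ 1) :
    N ^ 2 * x * min (1 / x₁) N / (64 * Real.exp 1 ^ 3)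
      ≤ ∑ t ∈ Finset.range N, (1 - (1 - x) ^ (N - t))
          * ∑ s ∈ Finset.range t, (1 - x) ^ (2 * (t - 1 - s)) * (1 - x₁) ^ (2 * s) := by
  have hN' : (3 : ℝ) ≤ N := by exact_mod_cast hN
  have hx₁0 : 0 < x₁ := hx0.trans_le hx₁
  set m := min (1 / x₁) (N : ℝ) with hm
  have hm0 : 0 ≤ m := le_min (by positivity) (by linarith)
  have hexp := exp_neg_three_le hx0.le (by nlinarith) hNx
  have hinner : ∀ t ∈ Finset.range N, Real.exp (-3) * (t / N * m / 4)
      ≤ ∑ s ∈ Finset.range t, (1 - x) ^ (2 * (t - 1 - s)) * (1 - x₁) ^ (2 * s) := by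
    intro t ht
    have htN : t < N := Finset.mem_range.1 ht
    have hg : (t : ℝ) / N * m / 4 ≤ ∑ s ∈ Finset.range t, (1 - x₁) ^ (2 * s) := by
      have h1 := one_sub_mul_geom_sum_sq (1 - x₁) t
      have h2 := half_min_le_one_sub_pow hx₁0.le hx₁'.le (2 * t)
      rw [← h1] at h2
      have h3 : t / N * m * x₁ ≤ min 1 ((2 * t : ℕ) * x₁) := by
        have htN' : (t : ℝ) / N ≤ 1 := by
          rw [div_le_one (by linarith)]; exact_mod_cast htN.le
        refine le_min ?_ ?_
        · have : m * x₁ ≤ 1 := by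
            calc m * x₁ ≤ 1 / x₁ * x₁ := by gcongr; exact min_le_left _ _
              _ = 1 := by field_simp
          rw [mul_assoc]
          exact mul_le_one₀ htN' (by positivity) this
        · calc t / N * m * x₁ ≤ t / N * N * x₁ := by gcongr; exact min_le_right _ _
            _ = t * x₁ := by field_simp
            _ ≤ _ := by push_cast; nlinarith [mul_nonneg (Nat.cast_nonneg (α := ℝ) t) hx₁0.le]
      set G := ∑ s ∈ Finset.range t, (1 - x₁) ^ (2 * s)
      have hG : 0 ≤ G := Finset.sum_nonneg fun s _ => by
        have : 0 ≤ 1 - x₁ := by linarith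
        positivity
      have h4 : t / N * m / 4 * (2 * x₁) ≤ G * (2 * x₁) := by
        nlinarith [mul_nonneg hG (sq_nonneg x₁)]
      exact le_of_mul_le_mul_right h4 (by linarith)
    calc Real.exp (-3) * (t / N * m / 4)
        ≤ Real.exp (-3) * ∑ s ∈ Finset.range t, (1 - x₁) ^ (2 * s) := by gcongr
      _ ≤ _ := by
        rw [Finset.mul_sum]
        refine Finset.sum_le_sum fun s hs => ?_
        have hq : 0 ≤ 1 - x₁ := by linarith
        refine mul_le_mul_of_nonneg_right (hexp.trans ?_) (by positivity)
        exact pow_le_pow_of_le_one (by linarith) (by linarith) (by omega)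
  have hterm : ∀ t ∈ Finset.range N,
      Real.exp (-3) * m * x / (8 * N) * ((t : ℝ) * (N - t)) ≤ (1 - (1 - x) ^ (N - t))
          * ∑ s ∈ Finset.range t, (1 - x) ^ (2 * (t - 1 - s)) * (1 - x₁) ^ (2 * s) := by
    intro t ht
    have htN : t < N := Finset.mem_range.1 ht
    have htN' : (0 : ℝ) ≤ N - t := by
      rw [sub_nonneg]; exact_mod_cast htN.le
    have h2 := half_min_le_one_sub_pow hx0.le (hx₁.trans hx₁'.le) (N - t)
    rw [Nat.cast_sub htN.le, min_eq_right (by nlinarith [Nat.cast_nonneg (α := ℝ) t])] at h2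
    calc _ = ((N - t) * x / 2) * (Real.exp (-3) * (t / N * m / 4)) := by field_simp; ring
      _ ≤ _ := mul_le_mul h2 (hinner t ht) (by positivity) ((by positivity : (0:ℝ) ≤ _).trans h2)
  refine le_trans ?_ (Finset.sum_le_sum hterm)
  rw [← Finset.mul_sum, sum_range_mul_sub_self, Real.exp_neg, ← Real.exp_nat_mul]
  have he : Real.exp ((3 : ℕ) * 1) = Real.exp 3 := by norm_num
  rw [he]
  have hE := Real.exp_pos 3
  have : (Real.exp 3)⁻¹ * m * x / (8 * N) * (N * ((N : ℝ) ^ 2 - 1) / 6)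
      - N ^ 2 * x * m / (64 * Real.exp 3) = m * x / (192 * Real.exp 3) * ((N : ℝ) ^ 2 - 4) := by
    field_simp
    ring
  have h9 : 0 ≤ m * x / (192 * Real.exp 3) * ((N : ℝ) ^ 2 - 4) :=
    mul_nonneg (by positivity) (by nlinarith)
  linarith

/-! ### The scalar recursions -/

/-- Summing the recursion for `b` produces `∑ a + 2 ∑ c`. One copy of `∑ c`, a double geometric sum,
combines with `∑ a` into the weights `1 - q^(N-t)`; the other copy is nonnegative and is discarded.
-/
theorem sum_le_of_recursion {a b c : ℕ → ℝ} {q : ℝ} {N : ℕ} (hq0 : 0 ≤ q)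
    (hq1 : q ≤ 1) (ha : ∀ t, 0 ≤ a t) (hb0 : b 0 = 0) (hc0 : c 0 = 0)
    (hb : ∀ t, b (t + 1) = b t + 2 * c t + a t)
    (hc : ∀ t, c (t + 1) = q * (c t + a t)) :
    ∑ t ∈ Finset.range N, (1 - q ^ (N - t)) * a t ≤ (1 - q) * b N := by
  have hcs : ∀ t, c t = ∑ s ∈ Finset.range t, q ^ (t - s) * a s := by
    intro t
    induction t with
    | zero => simp [hc0]
    | succ t ih =>
      rw [hc, ih, Finset.sum_range_succ, mul_add, Finset.mul_sum, Nat.add_sub_cancel_left, pow_one]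
      congr 1
      refine Finset.sum_congr rfl fun s hs => ?_
      rw [Nat.succ_sub (Finset.mem_range.1 hs).le, pow_succ']
      ring
  have hcn : ∀ t, 0 ≤ c t := fun t => by
    rw [hcs]
    exact Finset.sum_nonneg fun s _ => mul_nonneg (by positivity) (ha s)
  have key : ∀ t, (1 - q) * b t - ∑ s ∈ Finset.range t, (1 - q ^ (t - s)) * a s
      = (1 - q) * ∑ s ∈ Finset.range t, c s := by
    intro t
    induction t with
    | zero => simp [hb0]
    | succ t ih =>
      have h1 : ∑ s ∈ Finset.range t, (1 - q ^ (t + 1 - s)) * a s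
          = ∑ s ∈ Finset.range t, (1 - q ^ (t - s)) * a s
            + (1 - q) * ∑ s ∈ Finset.range t, q ^ (t - s) * a s := by
        rw [Finset.mul_sum, ← Finset.sum_add_distrib]
        refine Finset.sum_congr rfl fun s hs => ?_
        rw [Nat.succ_sub (Finset.mem_range.1 hs).le, pow_succ']
        ring
      rw [Finset.sum_range_succ, Finset.sum_range_succ, h1, ← hcs, hb, Nat.add_sub_cancel_left,
        pow_one, mul_add (1 - q) (∑ s ∈ Finset.range t, c s), ← ih]
      ring
  have hk := key N
  have : 0 ≤ (1 - q) * ∑ s ∈ Finset.range N, c s :=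
    mul_nonneg (by linarith) (Finset.sum_nonneg fun s _ => hcn s)
  linarith

theorem ge_of_recursion {a f : ℕ → ℝ} {q : ℝ}
    (ha : ∀ t, q ^ 2 * a t + f t ≤ a (t + 1)) (t : ℕ) :
    q ^ (2 * t) * a 0 + ∑ s ∈ Finset.range t, q ^ (2 * (t - 1 - s)) * f s ≤ a t := by
  induction t with
  | zero => simp
  | succ t ih =>
    refine le_trans (le_of_eq ?_)
      (le_trans (add_le_add_left (mul_le_mul_of_nonneg_left ih (sq_nonneg q)) (f t)) (ha t))
    have : ∀ s ∈ Finset.range t, q ^ (2 * (t + 1 - 1 - s)) * f s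
        = q ^ 2 * (q ^ (2 * (t - 1 - s)) * f s) := fun s hs => by
      have hs' := Finset.mem_range.1 hs
      rw [← mul_assoc, ← pow_add]
      congr 2
      omega
    rw [Finset.sum_range_succ, Finset.sum_congr rfl this, ← Finset.mul_sum]
    simp
    ring

/-- Here `Q t` stands for `𝔼⟪η_t, H η_t⟫`. Unrolling the recursion for `a` separates the initial
error, the multiplicative noise driven by `Q`, and the label noise; the sums are left in the form of
the elementary estimates. -/
theorem weighted_sum_ge {γ l l₁ β s2 Q₀ : ℝ} {N : ℕ} {a Q : ℕ → ℝ}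
    (hγ : 0 < γ) (hl : 0 < l) (hl₁ : l ≤ l₁) (hγl : γ * l₁ < 1) (hβ : 0 ≤ β) (hs2 : 0 ≤ s2)
    (hQ : ∀ t, (1 - γ * l₁) ^ (2 * t) * Q₀ ≤ Q t)
    (ha : ∀ t, (1 - γ * l) ^ 2 * a t + γ ^ 2 * l * (β * Q t + s2) ≤ a (t + 1)) :
    a 0 * ∑ t ∈ Finset.range N, (1 - (1 - γ * l) ^ (N - t)) * (1 - γ * l) ^ (2 * t)
      + γ ^ 2 * l * β * Q₀ * ∑ t ∈ Finset.range N, (1 - (1 - γ * l) ^ (N - t))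
          * ∑ s ∈ Finset.range t, (1 - γ * l) ^ (2 * (t - 1 - s)) * (1 - γ * l₁) ^ (2 * s)
      + γ * s2 / 2 * ∑ t ∈ Finset.range N, (1 - (1 - γ * l) ^ (N - t)) * (1 - (1 - γ * l) ^ t)
      ≤ ∑ t ∈ Finset.range N, (1 - (1 - γ * l) ^ (N - t)) * a t := by
  set q := 1 - γ * l with hq
  have hx0 : 0 < γ * l := mul_pos hγ hl
  have hx1 : γ * l < 1 := (mul_le_mul_of_nonneg_left hl₁ hγ.le).trans_lt hγl
  have hq0 : 0 < q := by linarith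
  have hq1 : q < 1 := by linarith
  rw [Finset.mul_sum, Finset.mul_sum, Finset.mul_sum, ← Finset.sum_add_distrib,
    ← Finset.sum_add_distrib]
  refine Finset.sum_le_sum fun t ht => ?_
  have hw : 0 ≤ 1 - q ^ (N - t) := sub_nonneg.2 (pow_le_one₀ hq0.le hq1.le)
  have hrec := ge_of_recursion ha t
  have hnoise : γ / 2 * (1 - q ^ t)
      ≤ γ ^ 2 * l * ∑ s ∈ Finset.range t, q ^ (2 * (t - 1 - s)) := by
    rw [Finset.sum_range_reflect (fun s => q ^ (2 * s)) t]
    have h1 := one_sub_mul_geom_sum_sq q t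
    set G := ∑ s ∈ Finset.range t, q ^ (2 * s)
    have hG : 0 ≤ G := Finset.sum_nonneg fun s _ => by positivity
    -- The exact geometric sum gives `1 - q^(2t)`; it is weakened to `1 - q^t` to match the variance
    -- sums.
    have h2 : q ^ (2 * t) ≤ q ^ t := pow_le_pow_of_le_one hq0.le hq1.le (by omega)
    have h3 : (1 - q) * (1 + q) * G ≤ 2 * (γ * l * G) := by
      have : 1 - q = γ * l := by rw [hq]; ring
      rw [this]
      nlinarith [mul_nonneg hx0.le hG]
    nlinarith
  have hsum : γ ^ 2 * l * β * Q₀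
          * ∑ s ∈ Finset.range t, q ^ (2 * (t - 1 - s)) * (1 - γ * l₁) ^ (2 * s)
        + γ ^ 2 * l * s2 * ∑ s ∈ Finset.range t, q ^ (2 * (t - 1 - s))
      ≤ ∑ s ∈ Finset.range t, q ^ (2 * (t - 1 - s)) * (γ ^ 2 * l * (β * Q s + s2)) := by
    rw [Finset.mul_sum, Finset.mul_sum, ← Finset.sum_add_distrib]
    refine Finset.sum_le_sum fun s _ => ?_
    have h1 := mul_le_mul_of_nonneg_left (hQ s)
      (by positivity : 0 ≤ γ ^ 2 * l * β * q ^ (2 * (t - 1 - s)))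
    linarith
  have h5 := mul_le_mul_of_nonneg_left hnoise hs2
  have h6 : a 0 * q ^ (2 * t) + γ ^ 2 * l * β * Q₀
          * ∑ s ∈ Finset.range t, q ^ (2 * (t - 1 - s)) * (1 - γ * l₁) ^ (2 * s)
        + γ * s2 / 2 * (1 - q ^ t) ≤ a t := by linarith
  have h7 := mul_le_mul_of_nonneg_left h6 hw
  linarith

theorem sum_le_coordinate {γ l : ℝ} {N : ℕ} {a b c : ℕ → ℝ} (hN : 0 < N)
    (hγ : 0 < γ) (hl : 0 < l) (hγl : γ * l ≤ 1)
    (ha0 : ∀ t, 0 ≤ a t) (hb0 : b 0 = 0) (hc0 : c 0 = 0)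
    (hb : ∀ t, b (t + 1) = b t + 2 * c t + a t)
    (hc : ∀ t, c (t + 1) = (1 - γ * l) * (c t + a t)) :
    1 / (2 * γ * N ^ 2) * ∑ t ∈ Finset.range N, (1 - (1 - γ * l) ^ (N - t)) * a t
      ≤ l * b N / (2 * N ^ 2) := by
  have hx0 : 0 < γ * l := mul_pos hγ hl
  have h := sum_le_of_recursion (N := N) (by linarith) (by linarith) ha0 hb0 hc0 hb hc
  have hN0 : (0 : ℝ) < N := by exact_mod_cast hN
  calc _ ≤ 1 / (2 * γ * N ^ 2) * ((1 - (1 - γ * l)) * b N) := by gcongr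
    _ = _ := by field_simp; ring

/-- Lower bound for the contribution of an eigendirection with large eigenvalue. -/
theorem head_coordinate_le {γ l l₁ β s2 Q₀ : ℝ} {N : ℕ} {a b c Q : ℕ → ℝ} (hN : 500 ≤ N)
    (hγ : 0 < γ) (hl : 0 < l) (hl₁ : l ≤ l₁) (hγl : γ * l₁ < 1) (hβ : 0 ≤ β) (hs2 : 0 ≤ s2)
    (hQ₀ : 0 ≤ Q₀) (hQ : ∀ t, (1 - γ * l₁) ^ (2 * t) * Q₀ ≤ Q t)
    (ha0 : ∀ t, 0 ≤ a t) (hb0 : b 0 = 0) (hc0 : c 0 = 0)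
    (hb : ∀ t, b (t + 1) = b t + 2 * c t + a t)
    (hc : ∀ t, c (t + 1) = (1 - γ * l) * (c t + a t))
    (ha : ∀ t, (1 - γ * l) ^ 2 * a t + γ ^ 2 * l * (β * Q t + s2) ≤ a (t + 1))
    (hNl : 1 / (N * γ) ≤ l) :
    1 / (16 * γ ^ 2 * N ^ 2) * (a 0 / l) + s2 / 50 * (1 / N) ≤ l * b N / (2 * N ^ 2) := by
  have hN0 : (0 : ℝ) < N := by exact_mod_cast (by omega : 0 < N)
  have hx0 : 0 < γ * l := mul_pos hγ hl
  have hx1 : γ * l < 1 := (mul_le_mul_of_nonneg_left hl₁ hγ.le).trans_lt hγl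
  have hNx : 1 ≤ N * (γ * l) := by
    rw [div_le_iff₀ (by positivity)] at hNl; linarith
  refine le_trans ?_ (sum_le_coordinate (by omega) hγ hl hx1.le ha0 hb0 hc0 hb hc)
  refine le_trans ?_ (mul_le_mul_of_nonneg_left
    (weighted_sum_ge (N := N) hγ hl hl₁ hγl hβ hs2 hQ ha) (by positivity))
  have h1 := sum_bias_ge hx0 hx1 N
  have h2 := sum_variance_ge_of_one_le_mul hx1.le (by omega : 5 ≤ N) hNx
  have h3 := half_min_le_one_sub_pow hx0.le hx1.le N
  rw [min_eq_left hNx] at h3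
  have h4 : 1 / (8 * (γ * l)) ≤ (1 - (1 - γ * l) ^ N) ^ 2 / (2 * (γ * l)) := by
    rw [div_le_div_iff₀ (by positivity) (by positivity)]
    nlinarith [mul_nonneg hx0.le (sub_nonneg.2 h3)]
  have hq : 0 ≤ 1 - γ * l := by linarith
  have hq₁ : 0 ≤ 1 - γ * l₁ := by linarith
  -- In the head, only the nonnegativity of the multiplicative noise contribution is kept.
  have h5 : 0 ≤ ∑ t ∈ Finset.range N, (1 - (1 - γ * l) ^ (N - t))
          * ∑ s ∈ Finset.range t, (1 - γ * l) ^ (2 * (t - 1 - s)) * (1 - γ * l₁) ^ (2 * s) :=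
    Finset.sum_nonneg fun t _ => mul_nonneg (sub_nonneg.2 (pow_le_one₀ hq (by linarith)))
      (Finset.sum_nonneg fun s _ => by positivity)
  -- The constants arise as `1/16 = 1/2 · 1/8` for the bias and `1/50 = 1/2 · 1/2 · 2/25` for the
  -- variance.
  calc _ = 1 / (2 * γ * N ^ 2) * (a 0 * (1 / (8 * (γ * l))) + 0
        + γ * s2 / 2 * (2 / 25 * (N : ℝ))) := by field_simp; ring
    _ ≤ _ := by
      gcongr
      · exact ha0 0
      · exact h4.trans h1
      · exact mul_nonneg (by positivity) h5

/-- Lower bound for the contribution of an eigendirection with small eigenvalue. -/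
theorem tail_coordinate_le {γ l l₁ β s2 Q₀ : ℝ} {N : ℕ} {a b c Q : ℕ → ℝ} (hN : 500 ≤ N)
    (hγ : 0 < γ) (hl : 0 < l) (hl₁ : l ≤ l₁) (hγl : γ * l₁ < 1) (hβ : 0 ≤ β) (hs2 : 0 ≤ s2)
    (hQ₀ : 0 ≤ Q₀) (hQ : ∀ t, (1 - γ * l₁) ^ (2 * t) * Q₀ ≤ Q t)
    (ha0 : ∀ t, 0 ≤ a t) (hb0 : b 0 = 0) (hc0 : c 0 = 0)
    (hb : ∀ t, b (t + 1) = b t + 2 * c t + a t)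
    (hc : ∀ t, c (t + 1) = (1 - γ * l) * (c t + a t))
    (ha : ∀ t, (1 - γ * l) ^ 2 * a t + γ ^ 2 * l * (β * Q t + s2) ≤ a (t + 1))
    (hNl : l ≤ 1 / (N * γ)) :
    1 / 16 * (l * a 0) + β * γ * Q₀ / (128 * Real.exp 1 ^ 3) * min (1 / l₁) (N * γ) * l ^ 2
      + s2 / 50 * (N * γ ^ 2 * l ^ 2) ≤ l * b N / (2 * N ^ 2) := by
  have hN0 : (0 : ℝ) < N := by exact_mod_cast (by omega : 0 < N)
  have hx0 : 0 < γ * l := mul_pos hγ hl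
  have hx₁ : γ * l ≤ γ * l₁ := mul_le_mul_of_nonneg_left hl₁ hγ.le
  have hx1 : γ * l < 1 := hx₁.trans_lt hγl
  have hl₁0 : 0 < l₁ := hl.trans_le hl₁
  have hNx : N * (γ * l) ≤ 1 := by
    rw [le_div_iff₀ (by positivity)] at hNl; linarith
  refine le_trans ?_ (sum_le_coordinate (by omega) hγ hl hx1.le ha0 hb0 hc0 hb hc)
  refine le_trans ?_ (mul_le_mul_of_nonneg_left
    (weighted_sum_ge (N := N) hγ hl hl₁ hγl hβ hs2 hQ ha) (by positivity))
  have h1 := sum_bias_ge hx0 hx1 N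
  have h2 := sum_variance_ge_of_mul_le_one hx0.le hx1.le (by omega : 5 ≤ N) hNx
  have h3 := half_min_le_one_sub_pow hx0.le hx1.le N
  rw [min_eq_right hNx] at h3
  have h4 : N ^ 2 * (γ * l) / 8 ≤ (1 - (1 - γ * l) ^ N) ^ 2 / (2 * (γ * l)) := by
    rw [le_div_iff₀ (by positivity)]
    have : (N * (γ * l) / 2) ^ 2 ≤ (1 - (1 - γ * l) ^ N) ^ 2 :=
      pow_le_pow_left₀ (by positivity) h3 2
    linarith
  have h5 := sum_noise_ge hx0 hx₁ hγl (by omega : 3 ≤ N) hNx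
  -- `sum_noise_ge` is stated for the dimensionless `x₁ = γ l₁`; one factor `γ` restores the scale.
  have hmin : min (1 / l₁) (N * γ) = γ * min (1 / (γ * l₁)) N := by
    rw [mul_min_of_nonneg _ _ hγ.le, mul_comm (N : ℝ)]
    congr 1
    field_simp
  rw [hmin]
  set m := min (1 / (γ * l₁)) (N : ℝ)
  calc _ = 1 / (2 * γ * N ^ 2) * (a 0 * (N ^ 2 * (γ * l) / 8)
        + γ ^ 2 * l * β * Q₀ * (N ^ 2 * (γ * l) * m / (64 * Real.exp 1 ^ 3))
        + γ * s2 / 2 * (2 / 25 * (N : ℝ) ^ 3 * (γ * l) ^ 2)) := by field_simp; ring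
    _ ≤ _ := by
      gcongr
      · exact ha0 0
      · exact h4.trans h1

/-! ### Moments of the data distribution -/

section Moments

variable {E : Type*} [NormedAddCommGroup E] [InnerProductSpace ℝ E]

theorem outer_apply (x u : E) : outer x u = inner ℝ x u • x := by
  simp [outer]

theorem norm_outer (x : E) : ‖outer x‖ = ‖x‖ ^ 2 := by
  simp [outer, sq]

theorem outer_isPositive (x : E) : (outer x).IsPositive := by
  simp [outer]

theorem continuous_outer : Continuous (outer : E → E →L[ℝ] E) :=
  (InnerProductSpace.rankOne ℝ).continuous.clm_apply continuous_id

variable [CompleteSpace E] [SecondCountableTopology E] [MeasurableSpace E] [BorelSpace E]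
  {D : Measure (E × ℝ)} {wstar : E} {s2 : ℝ≥0} {β : ℝ}

theorem integrable_outer (hreg : Regularity D wstar) :
    Integrable (fun p : E × ℝ => outer p.1) D := by
  refine hreg.integrable_sq.mono' (continuous_outer.comp continuous_fst).aestronglyMeasurable ?_
  exact .of_forall fun p => (norm_outer p.1).le

theorem integrable_outer_comp (hreg : Regularity D wstar) (A : E →L[ℝ] E) :
    Integrable (fun p : E × ℝ => outer p.1 ∘L A ∘L outer p.1) D := by
  refine (hreg.integrable_fourth.const_mul ‖A‖).mono' ?_ ?_
  · have : Continuous fun p : E × ℝ => outer p.1 := continuous_outer.comp continuous_fst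
    exact (this.clm_comp (continuous_const.clm_comp this)).aestronglyMeasurable
  · refine .of_forall fun p => (ContinuousLinearMap.opNorm_comp_le _ _).trans ?_
    calc ‖outer p.1‖ * ‖A ∘L outer p.1‖ ≤ ‖outer p.1‖ * (‖A‖ * ‖outer p.1‖) := by
          gcongr; exact ContinuousLinearMap.opNorm_comp_le _ _
      _ = ‖A‖ * ‖p.1‖ ^ 4 := by rw [norm_outer]; ring

theorem inner_secondMoment (hreg : Regularity D wstar) (u w : E) :
    inner ℝ u (secondMoment D w) = ∫ p, inner ℝ u p.1 * inner ℝ w p.1 ∂D := by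
  rw [secondMoment, ContinuousLinearMap.integral_apply (integrable_outer hreg),
    ← integral_inner ((integrable_outer hreg).apply_continuousLinearMap w)]
  refine integral_congr_ae (.of_forall fun p => ?_)
  simp only [outer_apply, inner_smul_right, real_inner_comm w]
  ring

theorem inner_fourthMoment_outer (hreg : Regularity D wstar) (u w : E) :
    inner ℝ u (fourthMoment D (outer w) u) = ∫ p, inner ℝ w p.1 ^ 2 * inner ℝ u p.1 ^ 2 ∂D := by
  have hint := integrable_outer_comp hreg (outer w)
  rw [fourthMoment, ContinuousLinearMap.integral_apply hint,
    ← integral_inner (hint.apply_continuousLinearMap u)]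
  refine integral_congr_ae (.of_forall fun p => ?_)
  simp only [ContinuousLinearMap.comp_apply, outer_apply, inner_smul_right, real_inner_comm u,
    real_inner_comm w, map_smul]
  ring

theorem secondMoment_symm (hreg : Regularity D wstar) (u w : E) :
    inner ℝ (secondMoment D u) w = inner ℝ u (secondMoment D w) := by
  rw [real_inner_comm, inner_secondMoment hreg, inner_secondMoment hreg]
  simp only [mul_comm]

theorem integrable_inner_mul_inner (hreg : Regularity D wstar) (u w : E) :
    Integrable (fun p : E × ℝ => inner ℝ u p.1 * inner ℝ w p.1) D := by
  refine (hreg.integrable_sq.const_mul (‖u‖ * ‖w‖)).mono'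
    (Continuous.aestronglyMeasurable (by fun_prop)) (.of_forall fun p => ?_)
  rw [norm_mul]
  calc _ ≤ (‖u‖ * ‖p.1‖) * (‖w‖ * ‖p.1‖) := by gcongr <;> exact norm_inner_le_norm _ _
    _ = _ := by ring

theorem integrable_inner [IsProbabilityMeasure D] (hreg : Regularity D wstar) (u : E) :
    Integrable (fun p : E × ℝ => inner ℝ u p.1) D := by
  refine ((hreg.integrable_sq.add (integrable_const (1 : ℝ))).const_mul ‖u‖).mono'
    (Continuous.aestronglyMeasurable (by fun_prop)) (.of_forall fun p => ?_)
  refine (norm_inner_le_norm _ _).trans ?_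
  simp only [Pi.add_apply]
  gcongr
  nlinarith [sq_nonneg (‖p.1‖ - 1), norm_nonneg p.1]

/-- The third moment of `‖x‖` is dominated by the sum of the second and the fourth. -/
theorem integrable_inner_mul_inner_sq (hreg : Regularity D wstar) (u w : E) :
    Integrable (fun p : E × ℝ => inner ℝ u p.1 * inner ℝ w p.1 ^ 2) D := by
  refine ((hreg.integrable_sq.add hreg.integrable_fourth).const_mul (‖u‖ * ‖w‖ ^ 2)).mono'
    (Continuous.aestronglyMeasurable (by fun_prop)) (.of_forall fun p => ?_)
  rw [norm_mul, norm_pow]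
  calc _ ≤ (‖u‖ * ‖p.1‖) * (‖w‖ * ‖p.1‖) ^ 2 := by gcongr <;> exact norm_inner_le_norm _ _
    _ = ‖u‖ * ‖w‖ ^ 2 * ‖p.1‖ ^ 3 := by ring
    _ ≤ _ := by
      simp only [Pi.add_apply]
      gcongr
      nlinarith [sq_nonneg (‖p.1‖ * (‖p.1‖ - 1)), sq_nonneg (‖p.1‖ ^ 2), sq_nonneg ‖p.1‖]

theorem integrable_inner_sq_mul_inner_sq (hreg : Regularity D wstar) (u w : E) :
    Integrable (fun p : E × ℝ => inner ℝ u p.1 ^ 2 * inner ℝ w p.1 ^ 2) D := by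
  refine (hreg.integrable_fourth.const_mul (‖u‖ ^ 2 * ‖w‖ ^ 2)).mono'
    (Continuous.aestronglyMeasurable (by fun_prop)) (.of_forall fun p => ?_)
  rw [norm_mul, norm_pow, norm_pow]
  calc _ ≤ (‖u‖ * ‖p.1‖) ^ 2 * (‖w‖ * ‖p.1‖) ^ 2 := by
        gcongr <;> exact norm_inner_le_norm _ _
    _ = _ := by ring

theorem integrable_gaussian_noise (hwell : WellSpecified D wstar s2) :
    Integrable (fun p : E × ℝ => p.2 - inner ℝ wstar p.1) D ∧
      ∫ p, (p.2 - inner ℝ wstar p.1) ∂D = 0 := by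
  have h := hwell.noise_law
  have hmp : MeasurePreserving (fun p : E × ℝ => p.2 - inner ℝ wstar p.1) D (gaussianReal 0 s2) :=
    ⟨by fun_prop, h.map_eq⟩
  refine ⟨?_, ?_⟩
  · exact hmp.integrable_comp_of_integrable
      (memLp_one_iff_integrable.1 (memLp_id_gaussianReal (μ := 0) (v := s2) 1))
  · rw [h.integral_eq, integral_id_gaussianReal]

theorem integrable_gaussian_noise_sq (hwell : WellSpecified D wstar s2) :
    Integrable (fun p : E × ℝ => (p.2 - inner ℝ wstar p.1) ^ 2) D ∧
      ∫ p, (p.2 - inner ℝ wstar p.1) ^ 2 ∂D = s2 := by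
  have h := hwell.noise_law
  have hmp : MeasurePreserving (fun p : E × ℝ => p.2 - inner ℝ wstar p.1) D (gaussianReal 0 s2) :=
    ⟨by fun_prop, h.map_eq⟩
  refine ⟨?_, ?_⟩
  · exact hmp.integrable_comp_of_integrable (g := fun x : ℝ => x ^ 2)
      (memLp_id_gaussianReal (μ := 0) (v := s2) 2).integrable_sq
  · have h1 := variance_id_gaussianReal (μ := 0) (v := s2)
    rw [variance_of_integral_eq_zero aemeasurable_id (by simp)] at h1
    rw [← h1]
    exact h.integral_comp (f := fun x : ℝ => x ^ 2) (by fun_prop)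

theorem noise_mul (hwell : WellSpecified D wstar s2) {f : ℝ → ℝ} (hf : Measurable f)
    (hfi : Integrable (fun p : E × ℝ => f (p.2 - inner ℝ wstar p.1)) D) {g : E → ℝ}
    (hg : Measurable g) (hgi : Integrable (fun p : E × ℝ => g p.1) D) :
    Integrable (fun p : E × ℝ => f (p.2 - inner ℝ wstar p.1) * g p.1) D ∧
      ∫ p, f (p.2 - inner ℝ wstar p.1) * g p.1 ∂D
        = (∫ p, f (p.2 - inner ℝ wstar p.1) ∂D) * ∫ p, g p.1 ∂D := by
  have hi := hwell.noise_indep.symm.comp hf hg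
  exact ⟨hi.integrable_mul hfi hgi,
    hi.integral_mul_eq_mul_integral hfi.aestronglyMeasurable hgi.aestronglyMeasurable⟩

/-- The centred update `u ↦ u + γ (ε - ⟪u, x⟫) x`, where `ε = y - ⟪wstar, x⟫`. -/
noncomputable def centredStep (γ : ℝ) (wstar : E) (u : E) (p : E × ℝ) : E :=
  u + (γ * (p.2 - inner ℝ wstar p.1 - inner ℝ u p.1)) • p.1

variable [IsProbabilityMeasure D]

theorem integral_inner_centredStep (hreg : Regularity D wstar) (hwell : WellSpecified D wstar s2)
    (γ : ℝ) (u w : E) :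
    ∫ p, inner ℝ w (centredStep γ wstar u p) ∂D
      = inner ℝ w u - γ * inner ℝ w (secondMoment D u) := by
  obtain ⟨h1, h2⟩ := integrable_gaussian_noise hwell
  obtain ⟨h3, h4⟩ := noise_mul hwell measurable_id h1 (g := fun x => inner ℝ w x) (by fun_prop)
    (integrable_inner hreg w)
  simp only [id] at h3 h4
  have h5 := integrable_inner_mul_inner hreg w u
  calc _ = ∫ p, (inner ℝ w u + (γ * ((p.2 - inner ℝ wstar p.1) * inner ℝ w p.1)
        + -γ * (inner ℝ w p.1 * inner ℝ u p.1))) ∂D := by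
        refine integral_congr_ae (.of_forall fun p => ?_)
        simp only [centredStep, inner_add_right, inner_smul_right]
        ring
    _ = _ := by
      rw [integral_add (integrable_const _) ((h3.const_mul γ).fun_add (h5.const_mul (-γ))),
        integral_add (h3.const_mul γ) (h5.const_mul (-γ)), integral_const_mul, integral_const_mul, h4,
        h2, inner_secondMoment hreg]
      simp
      ring

/-- After expanding the square, the terms linear in the noise vanish because it is centred and
independent of `x`; its square contributes the `s2` term. -/
theorem integral_inner_centredStep_sq (hreg : Regularity D wstar)
    (hwell : WellSpecified D wstar s2) (γ : ℝ) (u w : E) :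
    ∫ p, inner ℝ w (centredStep γ wstar u p) ^ 2 ∂D
      = inner ℝ w u ^ 2 - 2 * γ * inner ℝ w u * inner ℝ w (secondMoment D u)
        + γ ^ 2 * inner ℝ w (fourthMoment D (outer u) w)
        + γ ^ 2 * s2 * inner ℝ w (secondMoment D w) := by
  obtain ⟨h1, h2⟩ := integrable_gaussian_noise hwell
  obtain ⟨h1', h2'⟩ := integrable_gaussian_noise_sq hwell
  obtain ⟨h3, h4⟩ := noise_mul hwell measurable_id h1 (g := fun x => inner ℝ w x) (by fun_prop)
    (integrable_inner hreg w)
  obtain ⟨h3', h4'⟩ := noise_mul hwell measurable_id h1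
    (g := fun x => inner ℝ u x * inner ℝ w x ^ 2) (by fun_prop)
    (integrable_inner_mul_inner_sq hreg u w)
  obtain ⟨h3'', h4''⟩ := noise_mul hwell (f := fun x => x ^ 2) (by fun_prop) h1'
    (g := fun x => inner ℝ w x * inner ℝ w x) (by fun_prop)
    (integrable_inner_mul_inner hreg w w)
  simp only [id] at h3 h4 h3' h4'
  have h5 := integrable_inner_mul_inner hreg w u
  have h6 := integrable_inner_sq_mul_inner_sq hreg u w
  calc _ = ∫ p, (inner ℝ w u ^ 2
        + (2 * γ * inner ℝ w u * ((p.2 - inner ℝ wstar p.1) * inner ℝ w p.1)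
        + (-(2 * γ * inner ℝ w u) * (inner ℝ w p.1 * inner ℝ u p.1)
        + (γ ^ 2 * ((p.2 - inner ℝ wstar p.1) ^ 2 * (inner ℝ w p.1 * inner ℝ w p.1))
        + (-(2 * γ ^ 2) * ((p.2 - inner ℝ wstar p.1) * (inner ℝ u p.1 * inner ℝ w p.1 ^ 2))
        + γ ^ 2 * (inner ℝ u p.1 ^ 2 * inner ℝ w p.1 ^ 2)))))) ∂D := by
        refine integral_congr_ae (.of_forall fun p => ?_)
        simp only [centredStep, inner_add_right, inner_smul_right]
        ring
    _ = _ := by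
      have i6 := h6.const_mul (γ ^ 2)
      have i5 := (h3'.const_mul (-(2 * γ ^ 2))).fun_add i6
      have i4 := (h3''.const_mul (γ ^ 2)).fun_add i5
      have i3 := (h5.const_mul (-(2 * γ * inner ℝ w u))).fun_add i4
      have i2 := (h3.const_mul (2 * γ * inner ℝ w u)).fun_add i3
      rw [integral_add (integrable_const _) i2, integral_add (h3.const_mul _) i3,
        integral_add (h5.const_mul _) i4, integral_add (h3''.const_mul _) i5,
        integral_add (h3'.const_mul _) i6]
      simp only [integral_const_mul, h4, h4', h4'', h2, h2']
      rw [inner_secondMoment hreg, inner_secondMoment hreg, inner_fourthMoment_outer hreg]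
      simp
      ring

theorem norm_centredStep_sq_le (γ : ℝ) (u : E) (p : E × ℝ) :
    ‖centredStep γ wstar u p‖ ^ 2
      ≤ 3 * (‖u‖ ^ 2 + γ ^ 2 * ((p.2 - inner ℝ wstar p.1) ^ 2 * ‖p.1‖ ^ 2)
        + γ ^ 2 * (‖u‖ ^ 2 * ‖p.1‖ ^ 4)) := by
  set ε := p.2 - inner ℝ wstar p.1 with hε
  have h1 : ‖centredStep γ wstar u p‖ ≤ ‖u‖ + |γ| * (|ε| * ‖p.1‖) + |γ| * (‖u‖ * ‖p.1‖ ^ 2) := by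
    have h2 : |ε - inner ℝ u p.1| ≤ |ε| + ‖u‖ * ‖p.1‖ :=
      (abs_sub _ _).trans (by gcongr; exact abs_real_inner_le_norm _ _)
    calc _ ≤ ‖u‖ + ‖(γ * (ε - inner ℝ u p.1)) • p.1‖ := norm_add_le _ _
      _ = ‖u‖ + |γ| * |ε - inner ℝ u p.1| * ‖p.1‖ := by
        rw [norm_smul, Real.norm_eq_abs, abs_mul]
      _ ≤ ‖u‖ + |γ| * (|ε| + ‖u‖ * ‖p.1‖) * ‖p.1‖ := by gcongr
      _ = _ := by ring
  have h3 := pow_le_pow_left₀ (norm_nonneg _) h1 2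
  rw [← sq_abs γ, ← sq_abs ε]
  set a := ‖u‖
  set b := |γ| * (|ε| * ‖p.1‖) with hb
  set c := |γ| * (a * ‖p.1‖ ^ 2) with hc
  have hb2 : |γ| ^ 2 * (|ε| ^ 2 * ‖p.1‖ ^ 2) = b ^ 2 := by rw [hb]; ring
  have hc2 : |γ| ^ 2 * (a ^ 2 * ‖p.1‖ ^ 4) = c ^ 2 := by rw [hc]; ring
  rw [hb2, hc2]
  nlinarith [sq_nonneg (a - b), sq_nonneg (b - c), sq_nonneg (a - c)]

theorem integrable_noise_sq_mul_norm_sq (hreg : Regularity D wstar)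
    (hwell : WellSpecified D wstar s2) :
    Integrable (fun p : E × ℝ => (p.2 - inner ℝ wstar p.1) ^ 2 * ‖p.1‖ ^ 2) D :=
  (noise_mul hwell (f := fun x => x ^ 2) (by fun_prop) (integrable_gaussian_noise_sq hwell).1
    (g := fun x => ‖x‖ ^ 2) (by fun_prop) hreg.integrable_sq).1

/-- The excess risk is half the squared `H`-norm. -/
theorem risk_eq (hreg : Regularity D wstar) (hwell : WellSpecified D wstar s2) (u : E) :
    risk D (wstar + u) = risk D wstar + 1 / 2 * inner ℝ u (secondMoment D u) := by
  obtain ⟨h1, h2⟩ := integrable_gaussian_noise hwell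
  obtain ⟨h1', h2'⟩ := integrable_gaussian_noise_sq hwell
  obtain ⟨h3, h4⟩ := noise_mul hwell measurable_id h1 (g := fun x => inner ℝ u x) (by fun_prop)
    (integrable_inner hreg u)
  simp only [id] at h3 h4
  have h5 := integrable_inner_mul_inner hreg u u
  have key : ∫ p, (p.2 - inner ℝ (wstar + u) p.1) ^ 2 ∂D
      = (∫ p, (p.2 - inner ℝ wstar p.1) ^ 2 ∂D) + inner ℝ u (secondMoment D u) := by
    calc _ = ∫ p, ((p.2 - inner ℝ wstar p.1) ^ 2
          + (-2 * ((p.2 - inner ℝ wstar p.1) * inner ℝ u p.1)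
          + inner ℝ u p.1 * inner ℝ u p.1)) ∂D := by
          refine integral_congr_ae (.of_forall fun p => ?_)
          simp only [inner_add_left]
          ring
      _ = _ := by
        rw [integral_add h1' ((h3.const_mul _).fun_add h5), integral_add (h3.const_mul _) h5,
          integral_const_mul, h4, h2, inner_secondMoment hreg]
        ring
  rw [risk, risk, key]
  ring

variable {d : ℕ∞} {lam : Idx d → ℝ} {v : HilbertBasis (Idx d) ℝ E}

theorem hasSum_lam_mul_inner_sq (hreg : Regularity D wstar)
    (heig : IsEigendecomposition (secondMoment D) lam v) (u : E) :
    HasSum (fun i => lam i * inner ℝ (v i) u ^ 2) (inner ℝ u (secondMoment D u)) := by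
  refine (v.hasSum_inner_mul_inner u (secondMoment D u)).congr_fun fun i => ?_
  rw [← secondMoment_symm hreg, heig.apply_eq, real_inner_smul_left, real_inner_comm u]
  ring

theorem lam_pos (hreg : Regularity D wstar) (heig : IsEigendecomposition (secondMoment D) lam v)
    (i : Idx d) : 0 < lam i := by
  have h := hreg.posDef (v i) (v.orthonormal.ne_zero i)
  rwa [heig.apply_eq, inner_smul_right, real_inner_self_eq_norm_sq, v.orthonormal.1 i, one_pow,
    mul_one] at h

/-- Each `λ_i` equals `𝔼⟪v_i, x⟫²`, so Bessel's inequality bounds all partial sums by `𝔼‖x‖²`. -/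
theorem summable_lam (hreg : Regularity D wstar)
    (heig : IsEigendecomposition (secondMoment D) lam v) : Summable lam := by
  refine summable_of_sum_le (c := ∫ p, ‖p.1‖ ^ 2 ∂D) (fun i => (lam_pos hreg heig i).le)
    fun F => ?_
  have h : ∀ i, lam i = ∫ p, inner ℝ (v i) p.1 * inner ℝ (v i) p.1 ∂D := fun i => by
    rw [← inner_secondMoment hreg, heig.apply_eq, inner_smul_right, real_inner_self_eq_norm_sq,
      v.orthonormal.1 i, one_pow, mul_one]
  rw [Finset.sum_congr rfl fun i _ => h i,
    ← integral_finsetSum _ fun i _ => integrable_inner_mul_inner hreg _ _]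
  refine integral_mono (integrable_finsetSum _ fun i _ => integrable_inner_mul_inner hreg _ _)
    hreg.integrable_sq fun p => ?_
  refine le_trans (le_of_eq ?_) (v.orthonormal.sum_inner_products_le p.1 (s := F))
  refine Finset.sum_congr rfl fun i _ => ?_
  rw [Real.norm_eq_abs, sq_abs, sq]

theorem traceIn_comp_outer (u : E) :
    traceIn v (secondMoment D ∘L outer u) = inner ℝ u (secondMoment D u) := by
  rw [traceIn, ← v.tsum_inner_mul_inner]
  refine tsum_congr fun i => ?_
  simp [outer_apply, inner_smul_right]

/-- The fourth moment condition on rank one operators, tested on an eigenvector. -/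
theorem le_inner_fourthMoment_outer (hreg : Regularity D wstar)
    (heig : IsEigendecomposition (secondMoment D) lam v) (hfourth : FourthMomentLowerBound D v β)
    (u : E) (i : Idx d) :
    lam i ^ 2 * inner ℝ (v i) u ^ 2 + β * lam i * inner ℝ u (secondMoment D u)
      ≤ inner ℝ (v i) (fourthMoment D (outer u) (v i)) := by
  have h := (ContinuousLinearMap.le_def _ _).1 (hfourth _ (outer_isPositive u))
  have h1 := h.inner_nonneg_right (v i)
  rw [traceIn_comp_outer] at h1
  simp only [sub_apply, smul_apply,
    ContinuousLinearMap.comp_apply, heig.apply_eq, outer_apply, map_smul, inner_sub_right,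
    inner_smul_right] at h1
  rw [← secondMoment_symm hreg, heig.apply_eq, real_inner_smul_left, real_inner_self_eq_norm_sq,
    v.orthonormal.1 i, real_inner_comm (v i) u] at h1
  linarith

/-- The `HAH` part of the fourth moment condition supplies the `γ²λ²` term that completes the square
`(1 - γλ)²`; the rest is the injected noise. -/
theorem integral_inner_centredStep_sq_ge (hreg : Regularity D wstar)
    (hwell : WellSpecified D wstar s2) (heig : IsEigendecomposition (secondMoment D) lam v)
    (hfourth : FourthMomentLowerBound D v β) (γ : ℝ) (u : E) (i : Idx d) :
    (1 - γ * lam i) ^ 2 * inner ℝ (v i) u ^ 2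
        + γ ^ 2 * lam i * (β * inner ℝ u (secondMoment D u) + s2)
      ≤ ∫ p, inner ℝ (v i) (centredStep γ wstar u p) ^ 2 ∂D := by
  rw [integral_inner_centredStep_sq hreg hwell, ← secondMoment_symm hreg (v i) u, heig.apply_eq,
    real_inner_smul_left, inner_smul_right, real_inner_self_eq_norm_sq, v.orthonormal.1 i]
  have h := mul_le_mul_of_nonneg_left (le_inner_fourthMoment_outer hreg heig hfourth u i)
    (sq_nonneg γ)
  linarith

theorem integral_inner_eigenvector_centredStep (hreg : Regularity D wstar)
    (hwell : WellSpecified D wstar s2) (heig : IsEigendecomposition (secondMoment D) lam v)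
    (γ : ℝ) (u : E) (i : Idx d) :
    ∫ p, inner ℝ (v i) (centredStep γ wstar u p) ∂D = (1 - γ * lam i) * inner ℝ (v i) u := by
  rw [integral_inner_centredStep hreg hwell, ← secondMoment_symm hreg, heig.apply_eq,
    real_inner_smul_left]
  ring

end Moments

/-! ### The law of the iterates -/

section Trajectory

variable {E : Type*} [NormedAddCommGroup E] [InnerProductSpace ℝ E]

/-- One step of the pair (sum of the previous centred iterates, current centred iterate). -/
noncomputable def stateStep (γ : ℝ) (wstar : E) (X : E × E) (p : E × ℝ) : E × E :=
  (X.1 + X.2, centredStep γ wstar X.2 p)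

/-- The pair (sum of the previous centred iterates, current centred iterate). -/
noncomputable def state (γ : ℝ) (wstar w₀ : E) (z : ℕ → E × ℝ) (t : ℕ) : E × E :=
  (∑ r ∈ Finset.range t, (sgd γ w₀ z r - wstar), sgd γ w₀ z t - wstar)

theorem state_zero (γ : ℝ) (wstar w₀ : E) (z : ℕ → E × ℝ) :
    state γ wstar w₀ z 0 = (0, w₀ - wstar) := by
  simp [state, sgd]

theorem state_succ (γ : ℝ) (wstar w₀ : E) (z : ℕ → E × ℝ) (t : ℕ) :
    state γ wstar w₀ z (t + 1) = stateStep γ wstar (state γ wstar w₀ z t) (z t) := by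
  rw [state, stateStep, state, Finset.sum_range_succ, centredStep, sgd]
  refine Prod.ext rfl ?_
  simp only [inner_sub_left]
  rw [sub_sub_sub_cancel_right]
  abel

theorem state_congr {γ : ℝ} {wstar w₀ : E} {z z' : ℕ → E × ℝ} {t : ℕ}
    (h : ∀ r < t, z r = z' r) : state γ wstar w₀ z t = state γ wstar w₀ z' t := by
  induction t with
  | zero => simp [state_zero]
  | succ t ih =>
    rw [state_succ, state_succ, ih fun r hr => h r (by omega), h t (by omega)]

theorem avgIterate_eq {γ : ℝ} {wstar w₀ : E} {z : ℕ → E × ℝ} {N : ℕ} (hN : 0 < N) :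
    avgIterate γ w₀ z N = wstar + (N : ℝ)⁻¹ • (state γ wstar w₀ z N).1 := by
  have : (N : ℝ) ≠ 0 := by positivity
  rw [avgIterate, state, Finset.sum_sub_distrib, smul_sub]
  simp [← Nat.cast_smul_eq_nsmul ℝ, smul_smul, this]

theorem continuous_stateStep (γ : ℝ) (wstar : E) :
    Continuous fun q : (E × E) × (E × ℝ) => stateStep γ wstar q.1 q.2 := by
  unfold stateStep centredStep
  fun_prop

variable [CompleteSpace E] [SecondCountableTopology E] [MeasurableSpace E] [BorelSpace E]

theorem measurable_stateStep (γ : ℝ) (wstar : E) :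
    Measurable fun q : (E × E) × (E × ℝ) => stateStep γ wstar q.1 q.2 :=
  (continuous_stateStep γ wstar).measurable

theorem measurable_state (γ : ℝ) (wstar w₀ : E) (t : ℕ) :
    Measurable fun z : ℕ → E × ℝ => state γ wstar w₀ z t := by
  induction t with
  | zero => simp only [state_zero]; exact measurable_const
  | succ t ih =>
    simp only [state_succ]
    exact (measurable_stateStep γ wstar).comp (ih.prodMk (measurable_pi_apply t))

/-- The law of `state` when the samples are independent with law `D`. -/
noncomputable def stateLaw (D : Measure (E × ℝ)) (γ : ℝ) (wstar u : E) : ℕ → Measure (E × E)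
  | 0 => Measure.dirac (0, u)
  | t + 1 => ((stateLaw D γ wstar u t).prod D).map fun q => stateStep γ wstar q.1 q.2

variable {D : Measure (E × ℝ)} [IsProbabilityMeasure D] {wstar : E} {s2 : ℝ≥0} {β : ℝ}

instance isProbabilityMeasure_stateLaw (γ : ℝ) (u : E) (t : ℕ) :
    IsProbabilityMeasure (stateLaw D γ wstar u t) := by
  induction t with
  | zero => rw [stateLaw]; infer_instance
  | succ t ih =>
    rw [stateLaw]
    exact Measure.isProbabilityMeasure_map (measurable_stateStep γ wstar).aemeasurable

/-- The state at time `t` is a measurable function of the samples before `t`, a block disjoint from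
sample `t`. -/
theorem indepFun_state {Ω : Type*} [MeasurableSpace Ω] {P : Measure Ω} [IsProbabilityMeasure P]
    {N : ℕ} {Z : ℕ → Ω → E × ℝ} (hZ : ∀ t < N, AEMeasurable (Z t) P)
    (hindep : iIndepFun (fun t : Fin N => Z t) P) (γ : ℝ) (w₀ : E) {t : ℕ} (ht : t < N) :
    IndepFun (fun ω => state γ wstar w₀ (fun r => Z r ω) t) (Z t) P := by
  classical
  set S : Finset (Fin N) := Finset.univ.filter fun i => i.1 < t with hS
  have hdisj : Disjoint S {⟨t, ht⟩} := by simp [hS]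
  have h := hindep.indepFun_finset₀ S {⟨t, ht⟩} hdisj fun i => hZ i i.2
  -- A finite block is padded by zeros to a full sequence; by `state_congr` the padding does not
  -- affect the state at time `t`.
  let ext : (S → E × ℝ) → ℕ → E × ℝ := fun y r =>
    if hr : ∃ i : S, i.1.1 = r then y hr.choose else 0
  have hext : Measurable ext := by
    refine measurable_pi_lambda _ fun r => ?_
    by_cases hr : ∃ i : S, i.1.1 = r
    · simp only [ext, hr, dif_pos]
      exact measurable_pi_apply _
    · simp only [ext, hr, dif_neg, not_false_eq_true]
      exact measurable_const
  have h2 := h.comp ((measurable_state γ wstar w₀ t).comp hext)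
    (measurable_pi_apply (⟨⟨t, ht⟩, by simp⟩ : ({⟨t, ht⟩} : Finset (Fin N))))
  have heq : (fun ω => state γ wstar w₀ (fun r => Z r ω) t)
      = ((fun z => state γ wstar w₀ z t) ∘ ext) ∘ fun ω (i : S) => Z i.1 ω := by
    funext ω
    refine state_congr fun r hr => ?_
    have hr' : ∃ i : S, i.1.1 = r := ⟨⟨⟨r, hr.trans ht⟩, by simp [hS, hr]⟩, rfl⟩
    simp only [ext, hr', dif_pos]
    rw [hr'.choose_spec]
  rw [heq]
  exact h2

theorem hasLaw_state {Ω : Type*} [MeasurableSpace Ω] {P : Measure Ω} [IsProbabilityMeasure P]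
    {N : ℕ} {Z : ℕ → Ω → E × ℝ} (hlaw : ∀ t < N, HasLaw (Z t) D P)
    (hindep : iIndepFun (fun t : Fin N => Z t) P) (γ : ℝ) (w₀ : E) {t : ℕ} (ht : t ≤ N) :
    HasLaw (fun ω => state γ wstar w₀ (fun r => Z r ω) t)
      (stateLaw D γ wstar (w₀ - wstar) t) P := by
  induction t with
  | zero =>
    simp only [state_zero]
    exact ⟨aemeasurable_const, by simp [stateLaw]⟩
  | succ t ih =>
    have ih := ih (by omega)
    have hZ := hlaw t (by omega)
    have hi := indepFun_state (wstar := wstar) (fun r hr => (hlaw r hr).aemeasurable) hindep γ w₀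
      (Nat.lt_of_succ_le ht)
    have hpair := (indepFun_iff_map_prod_eq_prod_map_map ih.aemeasurable hZ.aemeasurable).1 hi
    rw [ih.map_eq, hZ.map_eq] at hpair
    simp only [state_succ]
    have hm : HasLaw (fun q : (E × E) × (E × ℝ) => stateStep γ wstar q.1 q.2)
        (stateLaw D γ wstar (w₀ - wstar) (t + 1))
        ((stateLaw D γ wstar (w₀ - wstar) t).prod D) :=
      ⟨(measurable_stateStep γ wstar).aemeasurable, rfl⟩
    exact hm.fun_comp ⟨ih.aemeasurable.prodMk hZ.aemeasurable, hpair⟩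

theorem integrable_stateLaw_succ {γ : ℝ} {u : E} {t : ℕ} {f : E × E → ℝ} (hf : Continuous f) :
    Integrable f (stateLaw D γ wstar u (t + 1)) ↔
      Integrable (fun q : (E × E) × (E × ℝ) => f (stateStep γ wstar q.1 q.2))
        ((stateLaw D γ wstar u t).prod D) :=
  integrable_map_measure hf.aestronglyMeasurable (measurable_stateStep γ wstar).aemeasurable

/-- Fubini in the role of conditioning on the past: the fresh sample is integrated first, with the
state frozen. -/
theorem integral_stateLaw_succ {γ : ℝ} {u : E} {t : ℕ} {f : E × E → ℝ} (hf : Continuous f)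
    (hfi : Integrable f (stateLaw D γ wstar u (t + 1))) :
    ∫ X, f X ∂stateLaw D γ wstar u (t + 1)
      = ∫ X, ∫ p, f (stateStep γ wstar X p) ∂D ∂stateLaw D γ wstar u t := by
  rw [stateLaw, integral_map (measurable_stateStep γ wstar).aemeasurable hf.aestronglyMeasurable,
    integral_prod _ ((integrable_stateLaw_succ hf).1 hfi)]

/-- Products such as `‖η_t‖² ‖x‖⁴` are integrable because state and sample live on different factors
of a product measure, so second moments of the state propagate using only fourth moments of `x`. -/
theorem integrable_norm_sq_stateLaw (hreg : Regularity D wstar) (hwell : WellSpecified D wstar s2)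
    (γ : ℝ) (u : E) (t : ℕ) :
    Integrable (fun X : E × E => ‖X.1‖ ^ 2 + ‖X.2‖ ^ 2) (stateLaw D γ wstar u t) := by
  induction t with
  | zero =>
    rw [stateLaw]
    exact integrable_dirac (by simp [enorm_lt_top])
  | succ t ih =>
    rw [integrable_stateLaw_succ (by fun_prop)]
    have h1 : Integrable (fun q : (E × E) × (E × ℝ) => (‖q.1.1‖ ^ 2 + ‖q.1.2‖ ^ 2) * ‖q.2.1‖ ^ 4)
      ((stateLaw D γ wstar u t).prod D) := ih.mul_prod hreg.integrable_fourth
    have h2 := ih.comp_fst D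
    have h3 := (integrable_noise_sq_mul_norm_sq hreg hwell).comp_snd (stateLaw D γ wstar u t)
    -- The constant is `5 = 2 + 3`: 2 from `‖S + η‖² ≤ 2(‖S‖² + ‖η‖²)` and 3 from
    -- `norm_centredStep_sq_le`.
    refine (((h2.const_mul 5).add (h3.const_mul (3 * γ ^ 2))).add
      (h1.const_mul (3 * γ ^ 2))).mono' ?_ (.of_forall fun q => ?_)
    · have hc : Continuous fun X : E × E => ‖X.1‖ ^ 2 + ‖X.2‖ ^ 2 := by fun_prop
      exact (hc.comp (continuous_stateStep γ wstar)).aestronglyMeasurable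
    · rw [Real.norm_of_nonneg (by positivity)]
      have h4 := norm_centredStep_sq_le (wstar := wstar) γ q.1.2 q.2
      have h5 := pow_le_pow_left₀ (norm_nonneg _) (norm_add_le q.1.1 q.1.2) 2
      have h6 : 0 ≤ γ ^ 2 * (‖q.1.1‖ ^ 2 * ‖q.2.1‖ ^ 4) := by positivity
      simp only [stateStep, Pi.add_apply]
      nlinarith [sq_nonneg (‖q.1.1‖ - ‖q.1.2‖), sq_nonneg ‖q.1.1‖, sq_nonneg ‖q.1.2‖]

theorem integrable_stateLaw_of_le (hreg : Regularity D wstar) (hwell : WellSpecified D wstar s2)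
    {γ : ℝ} {u : E} {t : ℕ} {f : E × E → ℝ} (hf : Continuous f) (C : ℝ)
    (hle : ∀ X, |f X| ≤ C * (‖X.1‖ ^ 2 + ‖X.2‖ ^ 2)) :
    Integrable f (stateLaw D γ wstar u t) :=
  ((integrable_norm_sq_stateLaw hreg hwell γ u t).const_mul C).mono' hf.aestronglyMeasurable
    (.of_forall hle)

theorem abs_inner_mul_inner_le {w a b : E} (hw : ‖w‖ = 1) :
    |inner ℝ w a * inner ℝ w b| ≤ 1 * (‖a‖ ^ 2 + ‖b‖ ^ 2) := by
  have h1 := abs_real_inner_le_norm w a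
  have h2 := abs_real_inner_le_norm w b
  rw [hw, one_mul] at h1 h2
  rw [abs_mul]
  calc _ ≤ ‖a‖ * ‖b‖ := by gcongr
    _ ≤ _ := by nlinarith [sq_nonneg (‖a‖ - ‖b‖), sq_nonneg ‖a‖, sq_nonneg ‖b‖]

theorem abs_inner_apply_le (T : E →L[ℝ] E) (a : E) :
    |inner ℝ a (T a)| ≤ ‖T‖ * ‖a‖ ^ 2 := by
  calc _ ≤ ‖a‖ * ‖T a‖ := abs_real_inner_le_norm _ _
    _ ≤ ‖a‖ * (‖T‖ * ‖a‖) := by gcongr; exact T.le_opNorm a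
    _ = _ := by ring

theorem integrable_inner_apply_fst (hreg : Regularity D wstar) (hwell : WellSpecified D wstar s2)
    (T : E →L[ℝ] E) (γ : ℝ) (u : E) (t : ℕ) :
    Integrable (fun X : E × E => inner ℝ X.1 (T X.1)) (stateLaw D γ wstar u t) :=
  integrable_stateLaw_of_le hreg hwell (by fun_prop) ‖T‖ fun X =>
    (abs_inner_apply_le T X.1).trans (by gcongr; nlinarith [sq_nonneg ‖X.2‖])

theorem integrable_inner_apply_snd (hreg : Regularity D wstar) (hwell : WellSpecified D wstar s2)
    (T : E →L[ℝ] E) (γ : ℝ) (u : E) (t : ℕ) :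
    Integrable (fun X : E × E => inner ℝ X.2 (T X.2)) (stateLaw D γ wstar u t) :=
  integrable_stateLaw_of_le hreg hwell (by fun_prop) ‖T‖ fun X =>
    (abs_inner_apply_le T X.2).trans (by gcongr; nlinarith [sq_nonneg ‖X.1‖])

/-! ### Moments of the coordinates -/

/-- `𝔼 ⟪w, η_t⟫²`, where `η_t` is the centred iterate. -/
noncomputable def iterateMoment (D : Measure (E × ℝ)) (γ : ℝ) (wstar u w : E) (t : ℕ) : ℝ :=
  ∫ X, inner ℝ w X.2 ^ 2 ∂stateLaw D γ wstar u t

/-- `𝔼 ⟪w, S_t⟫²`, where `S_t` is the sum of the centred iterates before time `t`. -/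
noncomputable def sumMoment (D : Measure (E × ℝ)) (γ : ℝ) (wstar u w : E) (t : ℕ) : ℝ :=
  ∫ X, inner ℝ w X.1 ^ 2 ∂stateLaw D γ wstar u t

/-- `𝔼 ⟪w, S_t⟫ ⟪w, η_t⟫`. -/
noncomputable def crossMoment (D : Measure (E × ℝ)) (γ : ℝ) (wstar u w : E) (t : ℕ) : ℝ :=
  ∫ X, inner ℝ w X.1 * inner ℝ w X.2 ∂stateLaw D γ wstar u t

/-- `𝔼 ⟪η_t, H η_t⟫`. -/
noncomputable def riskMoment (D : Measure (E × ℝ)) (γ : ℝ) (wstar u : E) (t : ℕ) : ℝ :=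
  ∫ X, inner ℝ X.2 (secondMoment D X.2) ∂stateLaw D γ wstar u t

theorem integrable_iterateMoment (hreg : Regularity D wstar) (hwell : WellSpecified D wstar s2)
    (γ : ℝ) (u : E) {w : E} (hw : ‖w‖ = 1) (t : ℕ) :
    Integrable (fun X : E × E => inner ℝ w X.2 ^ 2) (stateLaw D γ wstar u t) :=
  integrable_stateLaw_of_le hreg hwell (by fun_prop) 2 fun X => by
    rw [sq]
    refine (abs_inner_mul_inner_le hw).trans ?_
    nlinarith [sq_nonneg ‖X.1‖]

theorem integrable_sumMoment (hreg : Regularity D wstar) (hwell : WellSpecified D wstar s2)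
    (γ : ℝ) (u : E) {w : E} (hw : ‖w‖ = 1) (t : ℕ) :
    Integrable (fun X : E × E => inner ℝ w X.1 ^ 2) (stateLaw D γ wstar u t) :=
  integrable_stateLaw_of_le hreg hwell (by fun_prop) 2 fun X => by
    rw [sq]
    refine (abs_inner_mul_inner_le hw).trans ?_
    nlinarith [sq_nonneg ‖X.2‖]

theorem integrable_crossMoment (hreg : Regularity D wstar) (hwell : WellSpecified D wstar s2)
    (γ : ℝ) (u : E) {w : E} (hw : ‖w‖ = 1) (t : ℕ) :
    Integrable (fun X : E × E => inner ℝ w X.1 * inner ℝ w X.2) (stateLaw D γ wstar u t) :=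
  integrable_stateLaw_of_le hreg hwell (by fun_prop) 1 fun _ => abs_inner_mul_inner_le hw

theorem iterateMoment_zero (γ : ℝ) (u w : E) :
    iterateMoment D γ wstar u w 0 = inner ℝ w u ^ 2 := by
  rw [iterateMoment, stateLaw, integral_dirac]

theorem sumMoment_zero (γ : ℝ) (u w : E) : sumMoment D γ wstar u w 0 = 0 := by
  rw [sumMoment, stateLaw, integral_dirac]; simp

theorem crossMoment_zero (γ : ℝ) (u w : E) : crossMoment D γ wstar u w 0 = 0 := by
  rw [crossMoment, stateLaw, integral_dirac]; simp

theorem iterateMoment_nonneg (γ : ℝ) (u w : E) (t : ℕ) : 0 ≤ iterateMoment D γ wstar u w t :=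
  integral_nonneg fun _ => sq_nonneg _

theorem sumMoment_succ (hreg : Regularity D wstar) (hwell : WellSpecified D wstar s2)
    (γ : ℝ) (u : E) {w : E} (hw : ‖w‖ = 1) (t : ℕ) :
    sumMoment D γ wstar u w (t + 1) = sumMoment D γ wstar u w t
      + 2 * crossMoment D γ wstar u w t + iterateMoment D γ wstar u w t := by
  have h1 := integrable_sumMoment hreg hwell γ u hw t
  have h2 := integrable_crossMoment hreg hwell γ u hw t
  have h3 := integrable_iterateMoment hreg hwell γ u hw t
  rw [sumMoment, integral_stateLaw_succ (f := fun X => inner ℝ w X.1 ^ 2) (by fun_prop)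
    (integrable_sumMoment hreg hwell γ u hw _), sumMoment, crossMoment, iterateMoment,
    ← integral_const_mul, ← integral_add h1 (h2.const_mul 2),
    ← integral_add (h1.fun_add (h2.const_mul 2)) h3]
  refine integral_congr_ae (.of_forall fun X => ?_)
  simp only [stateStep, integral_const, inner_add_right]
  simp
  ring

variable {d : ℕ∞} {lam : Idx d → ℝ} {v : HilbertBasis (Idx d) ℝ E}

theorem crossMoment_succ (hreg : Regularity D wstar) (hwell : WellSpecified D wstar s2)
    (heig : IsEigendecomposition (secondMoment D) lam v) (γ : ℝ) (u : E) (i : Idx d) (t : ℕ) :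
    crossMoment D γ wstar u (v i) (t + 1) = (1 - γ * lam i)
      * (crossMoment D γ wstar u (v i) t + iterateMoment D γ wstar u (v i) t) := by
  have hw := v.orthonormal.1 i
  have h2 := integrable_crossMoment hreg hwell γ u hw t
  have h3 := integrable_iterateMoment hreg hwell γ u hw t
  rw [crossMoment, integral_stateLaw_succ (f := fun X => inner ℝ (v i) X.1 * inner ℝ (v i) X.2)
    (by fun_prop) (integrable_crossMoment hreg hwell γ u hw _), crossMoment, iterateMoment,
    ← integral_add h2 h3, ← integral_const_mul]
  refine integral_congr_ae (.of_forall fun X => ?_)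
  simp only [stateStep]
  rw [integral_const_mul, integral_inner_eigenvector_centredStep hreg hwell heig,
    inner_add_right]
  ring

theorem iterateMoment_succ_ge (hreg : Regularity D wstar) (hwell : WellSpecified D wstar s2)
    (heig : IsEigendecomposition (secondMoment D) lam v) (hfourth : FourthMomentLowerBound D v β)
    (γ : ℝ) (u : E) (i : Idx d) (t : ℕ) :
    (1 - γ * lam i) ^ 2 * iterateMoment D γ wstar u (v i) t
        + γ ^ 2 * lam i * (β * riskMoment D γ wstar u t + s2)
      ≤ iterateMoment D γ wstar u (v i) (t + 1) := by
  have hw := v.orthonormal.1 i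
  have h3 := (integrable_iterateMoment hreg hwell γ u hw t).const_mul ((1 - γ * lam i) ^ 2)
  have h4 := (((integrable_inner_apply_snd hreg hwell (secondMoment D) γ u t).const_mul β).fun_add
    (integrable_const (s2 : ℝ))).const_mul (γ ^ 2 * lam i)
  have hint := integrable_iterateMoment hreg hwell γ u hw (t + 1)
  rw [iterateMoment, iterateMoment, integral_stateLaw_succ (f := fun X => inner ℝ (v i) X.2 ^ 2)
    (by fun_prop) hint]
  have hs : β * riskMoment D γ wstar u t + s2
      = ∫ X, (β * inner ℝ X.2 (secondMoment D X.2) + s2) ∂stateLaw D γ wstar u t := by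
    rw [integral_add ((integrable_inner_apply_snd hreg hwell _ γ u t).const_mul β)
      (integrable_const _), integral_const_mul, riskMoment]
    simp
  rw [hs, ← integral_const_mul, ← integral_const_mul, ← integral_add h3 h4]
  refine integral_mono (h3.fun_add h4) ?_ fun X => ?_
  · exact ((integrable_stateLaw_succ (f := fun X => inner ℝ (v i) X.2 ^ 2) (by fun_prop)).1
      hint).integral_prod_left
  · exact integral_inner_centredStep_sq_ge hreg hwell heig hfourth γ X.2 i

theorem riskMoment_nonneg (hreg : Regularity D wstar) (γ : ℝ) (u : E) (t : ℕ) :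
    0 ≤ riskMoment D γ wstar u t :=
  integral_nonneg fun X => by
    by_cases h : X.2 = 0
    · simp [h]
    · exact (hreg.posDef _ h).le

theorem sum_lam_mul_inner_sq_le (hreg : Regularity D wstar)
    (heig : IsEigendecomposition (secondMoment D) lam v) (F : Finset (Idx d)) (u : E) :
    ∑ i ∈ F, lam i * inner ℝ (v i) u ^ 2 ≤ inner ℝ u (secondMoment D u) :=
  sum_le_hasSum F (fun i _ => mul_nonneg (lam_pos hreg heig i).le (sq_nonneg _))
    (hasSum_lam_mul_inner_sq hreg heig u)

/-- A lower bound on the risk needs only finitely many directions at a time, which avoids exchanging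
an infinite sum with the integral. -/
theorem sum_lam_mul_sumMoment_le (hreg : Regularity D wstar) (hwell : WellSpecified D wstar s2)
    (heig : IsEigendecomposition (secondMoment D) lam v) (γ : ℝ) (u : E) (F : Finset (Idx d))
    (t : ℕ) :
    ∑ i ∈ F, lam i * sumMoment D γ wstar u (v i) t
      ≤ ∫ X, inner ℝ X.1 (secondMoment D X.1) ∂stateLaw D γ wstar u t := by
  have h : ∀ i ∈ F, Integrable (fun X : E × E => lam i * inner ℝ (v i) X.1 ^ 2)
      (stateLaw D γ wstar u t) := fun i _ =>
    (integrable_sumMoment hreg hwell γ u (v.orthonormal.1 i) t).const_mul _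
  simp only [sumMoment, ← integral_const_mul]
  rw [← integral_finsetSum _ h]
  exact integral_mono (integrable_finsetSum _ h) (integrable_inner_apply_fst hreg hwell _ γ u t)
    fun X => sum_lam_mul_inner_sq_le hreg heig F X.1

theorem sum_lam_mul_iterateMoment_le (hreg : Regularity D wstar)
    (hwell : WellSpecified D wstar s2) (heig : IsEigendecomposition (secondMoment D) lam v)
    (γ : ℝ) (u : E) (F : Finset (Idx d)) (t : ℕ) :
    ∑ i ∈ F, lam i * iterateMoment D γ wstar u (v i) t ≤ riskMoment D γ wstar u t := by
  have h : ∀ i ∈ F, Integrable (fun X : E × E => lam i * inner ℝ (v i) X.2 ^ 2)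
      (stateLaw D γ wstar u t) := fun i _ =>
    (integrable_iterateMoment hreg hwell γ u (v.orthonormal.1 i) t).const_mul _
  simp only [iterateMoment, ← integral_const_mul]
  rw [← integral_finsetSum _ h]
  exact integral_mono (integrable_finsetSum _ h) (integrable_inner_apply_snd hreg hwell _ γ u t)
    fun X => sum_lam_mul_inner_sq_le hreg heig F X.2

/-- With the nonnegative noise dropped, direction `i` retains at least the factor `(1 - γλ_i)^(2t)`,
and the smallest such factor belongs to the top eigenvalue. -/
theorem pow_mul_le_riskMoment (hreg : Regularity D wstar) (hwell : WellSpecified D wstar s2)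
    (heig : IsEigendecomposition (secondMoment D) lam v) (hfourth : FourthMomentLowerBound D v β)
    (hβ : 0 ≤ β) {γ l₁ : ℝ} (hγ : 0 ≤ γ) (hl₁ : ∀ i, lam i ≤ l₁) (hγl : γ * l₁ ≤ 1) (u : E)
    (t : ℕ) :
    (1 - γ * l₁) ^ (2 * t) * inner ℝ u (secondMoment D u) ≤ riskMoment D γ wstar u t := by
  refine hasSum_le_of_sum_le ((hasSum_lam_mul_inner_sq hreg heig u).mul_left _) fun F => ?_
  refine le_trans (Finset.sum_le_sum fun i _ => ?_)
    (sum_lam_mul_iterateMoment_le hreg hwell heig γ u F t)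
  have hl := lam_pos hreg heig i
  have h1 : (1 - γ * lam i) ^ (2 * t) * inner ℝ (v i) u ^ 2
      ≤ iterateMoment D γ wstar u (v i) t := by
    have h := ge_of_recursion (a := iterateMoment D γ wstar u (v i)) (q := 1 - γ * lam i)
      (f := fun _ => 0) (fun s => le_trans (by
        have : 0 ≤ γ ^ 2 * lam i * (β * riskMoment D γ wstar u s + s2) := by
          have := riskMoment_nonneg hreg γ u s
          positivity
        linarith) (iterateMoment_succ_ge hreg hwell heig hfourth γ u i s)) t
    simpa [iterateMoment_zero] using h
  have h2 : (1 - γ * l₁) ^ (2 * t) ≤ (1 - γ * lam i) ^ (2 * t) :=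
    pow_le_pow_left₀ (by linarith) (by nlinarith [hl₁ i]) _
  calc _ = lam i * ((1 - γ * l₁) ^ (2 * t) * inner ℝ (v i) u ^ 2) := by ring
    _ ≤ lam i * ((1 - γ * lam i) ^ (2 * t) * inner ℝ (v i) u ^ 2) := by gcongr
    _ ≤ _ := by gcongr

end Trajectory

/-! ### The effective dimension -/

section EffDim

variable {d : ℕ∞} {lam : Idx d → ℝ} {N : ℕ} {γ : ℝ}

/-- Summable eigenvalues exceed a positive threshold only finitely often. Boundedness matters
because `sSup` of an unbounded set of naturals is `0`. -/
theorem bddAbove_effDim (hlam : Summable lam) (hN : 0 < N) (hγ : 0 < γ) :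
    BddAbove {k : ℕ | ∃ i : Idx d, k = i.1 + 1 ∧ 1 / (N * γ) ≤ lam i} := by
  have hthr : (0 : ℝ) < 1 / (N * γ) := by positivity
  have hfin : {i : Idx d | 1 / (N * γ) ≤ lam i}.Finite := by
    have h := (hlam.tendsto_cofinite_zero.eventually_lt_const hthr)
    rw [Filter.eventually_cofinite] at h
    simpa only [not_lt] using h
  refine ((hfin.image fun i => i.1 + 1).subset ?_).bddAbove
  rintro k ⟨i, rfl, hi⟩
  exact ⟨i, hi, rfl⟩

theorem exists_effDim_eq (hlam : Summable lam) (hN : 0 < N) (hγ : 0 < γ)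
    (hk : effDim lam N γ ≠ 0) :
    ∃ i : Idx d, effDim lam N γ = i.1 + 1 ∧ 1 / (N * γ) ≤ lam i := by
  refine Nat.sSup_mem ?_ (bddAbove_effDim hlam hN hγ)
  by_contra h
  exact hk (by rw [effDim, Set.not_nonempty_iff_eq_empty.1 h, Nat.sSup_def ⟨0, by simp⟩]; simp)

theorem lt_effDim_iff (hanti : Antitone lam) (hlam : Summable lam) (hN : 0 < N) (hγ : 0 < γ)
    (i : Idx d) : i.1 < effDim lam N γ ↔ 1 / (N * γ) ≤ lam i := by
  constructor
  · intro hi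
    obtain ⟨j, hj, hlj⟩ := exists_effDim_eq hlam hN hγ (by omega)
    have hij : i ≤ j := by
      rw [← Subtype.coe_le_coe]; omega
    exact hlj.trans (hanti hij)
  · intro hi
    exact le_csSup (bddAbove_effDim hlam hN hγ) ⟨i, rfl, hi⟩

theorem hasSum_ite_lt (f : Idx d → ℝ) (k : ℕ) :
    HasSum (fun i : Idx d => if i.1 < k then f i else 0)
      (∑ i ∈ (Finset.range k).subtype fun n : ℕ => (n : ℕ∞) < d, f i) := by
  have h := hasSum_sum_of_ne_finset_zero (L := .unconditional _)
    (f := fun i : Idx d => if i.1 < k then f i else 0)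
    (s := (Finset.range k).subtype fun n : ℕ => (n : ℕ∞) < d) fun i hi => by
      rw [if_neg]
      simpa using hi
  convert h using 1
  refine Finset.sum_congr rfl fun i hi => ?_
  rw [if_pos (by simpa using hi)]

/-- In finite dimension, counting exactly `effDim` indices requires every `n < effDim` to lie below
`d`; the index attaining the maximum guarantees this. -/
theorem hasSum_ite_lt_effDim (hlam : Summable lam) (hN : 0 < N) (hγ : 0 < γ) (c : ℝ) :
    HasSum (fun i : Idx d => if i.1 < effDim lam N γ then c else 0) (effDim lam N γ * c) := by
  convert hasSum_ite_lt (fun _ => c) (effDim lam N γ) using 1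
  rw [Finset.sum_const, nsmul_eq_mul, Finset.card_subtype, Finset.filter_true_of_mem,
    Finset.card_range]
  intro n hn
  have hn := Finset.mem_range.1 hn
  obtain ⟨j, hj, -⟩ := exists_effDim_eq hlam hN hγ (by omega)
  refine lt_of_le_of_lt ?_ j.2
  exact_mod_cast (by omega : n ≤ j.1)

end EffDim

/-! ### The lower bound -/

section LowerBound

variable {E : Type*} [NormedAddCommGroup E] [InnerProductSpace ℝ E] [CompleteSpace E]
  [SecondCountableTopology E] [MeasurableSpace E] [BorelSpace E]
  {D : Measure (E × ℝ)} [IsProbabilityMeasure D] {wstar : E} {s2 : ℝ≥0} {β : ℝ}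
  {d : ℕ∞} {lam : Idx d → ℝ} {v : HilbertBasis (Idx d) ℝ E}

/-- The risk of the averaged iterate is integrable, and its mean exceeds the minimal risk by
`𝔼 ⟪S_N, H S_N⟫ / (2 N²)`. -/
theorem integral_risk_avgIterate (hreg : Regularity D wstar) (hwell : WellSpecified D wstar s2)
    {N : ℕ} (hN : 0 < N) (γ : ℝ) (w₀ : E) {Ω : Type*} [MeasurableSpace Ω] {P : Measure Ω}
    [IsProbabilityMeasure P] {Z : ℕ → Ω → E × ℝ} (hlaw : ∀ t < N, HasLaw (Z t) D P)
    (hindep : iIndepFun (fun t : Fin N => Z t) P) :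
    Integrable (fun ω => risk D (avgIterate γ w₀ (fun t => Z t ω) N)) P ∧
      ∫ ω, risk D (avgIterate γ w₀ (fun t => Z t ω) N) ∂P = risk D wstar
        + (∫ X, inner ℝ X.1 (secondMoment D X.1) ∂stateLaw D γ wstar (w₀ - wstar) N)
          / (2 * N ^ 2) := by
  have hst := hasLaw_state (wstar := wstar) hlaw hindep γ w₀ le_rfl
  have hH := integrable_inner_apply_fst hreg hwell (secondMoment D) γ (w₀ - wstar) N
  have heq : ∀ z : ℕ → E × ℝ, risk D (avgIterate γ w₀ z N) = risk D wstar
      + 1 / (2 * (N : ℝ) ^ 2) * inner ℝ (state γ wstar w₀ z N).1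
        (secondMoment D (state γ wstar w₀ z N).1) := fun z => by
    rw [avgIterate_eq (wstar := wstar) hN, risk_eq hreg hwell]
    simp only [map_smul, real_inner_smul_left, inner_smul_right]
    field_simp
  simp only [heq]
  have hcomp : Integrable (fun ω => inner ℝ (state γ wstar w₀ (fun t => Z t ω) N).1
      (secondMoment D (state γ wstar w₀ (fun t => Z t ω) N).1)) P := by
    rw [← hst.map_eq] at hH
    exact hH.comp_aemeasurable hst.aemeasurable
  refine ⟨(integrable_const _).add (hcomp.const_mul _), ?_⟩
  rw [integral_add (integrable_const _) (hcomp.const_mul _), integral_const_mul,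
    ← hst.integral_comp (f := fun X : E × E => inner ℝ X.1 (secondMoment D X.1))
      hH.aestronglyMeasurable]
  simp
  ring

theorem lower_bound_le (hreg : Regularity D wstar) (hwell : WellSpecified D wstar s2)
    (hβ : 0 ≤ β) (hd : 0 < d) (heig : IsEigendecomposition (secondMoment D) lam v)
    (hfourth : FourthMomentLowerBound D v β) {N : ℕ} (hN : 500 ≤ N) {γ : ℝ} (hγ : 0 < γ)
    (hγ' : γ < 1 / lam ⟨0, hd⟩) (u : E) :
    1 / (16 * γ ^ 2 * N ^ 2) * headNormSq lam v (effDim lam N γ) u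
        + 1 / 16 * tailNormSq lam v (effDim lam N γ) u
        + β * γ * inner ℝ u (secondMoment D u) / (128 * Real.exp 1 ^ 3)
          * min (1 / lam ⟨0, hd⟩) (N * γ) * tailSumSq lam (effDim lam N γ)
        + s2 / 50 * ((effDim lam N γ : ℝ) / N + N * γ ^ 2 * tailSumSq lam (effDim lam N γ))
      ≤ (∫ X, inner ℝ X.1 (secondMoment D X.1) ∂stateLaw D γ wstar u N) / (2 * N ^ 2) := by
  have hN0 : 0 < N := by omega
  have hpos := lam_pos hreg heig
  have hsum := summable_lam hreg heig
  have hle : ∀ i, lam i ≤ lam ⟨0, hd⟩ := fun i => heig.antitone (Nat.zero_le i.1)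
  have hγl : γ * lam ⟨0, hd⟩ < 1 := (lt_div_iff₀ (hpos _)).1 hγ'
  set k := effDim lam N γ with hk
  set l₁ := lam ⟨0, hd⟩
  have hk_iff : ∀ i : Idx d, i.1 < k ↔ 1 / (N * γ) ≤ lam i :=
    lt_effDim_iff heig.antitone hsum hN0 hγ
  have s1 : HasSum (fun i : Idx d => if i.1 < k then inner ℝ (v i) u ^ 2 / lam i else 0)
      (headNormSq lam v k u) := (hasSum_ite_lt _ k).summable.hasSum
  have s2' : HasSum (fun i : Idx d => if k ≤ i.1 then lam i * inner ℝ (v i) u ^ 2 else 0)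
      (tailNormSq lam v k u) := by
    refine Summable.hasSum (Summable.of_nonneg_of_le (fun i => ?_) (fun i => ?_)
      (hasSum_lam_mul_inner_sq hreg heig u).summable)
    all_goals
      have := mul_nonneg (hpos i).le (sq_nonneg (inner ℝ (v i) u))
      split_ifs <;> simp [this]
  have s3 : HasSum (fun i : Idx d => if k ≤ i.1 then lam i ^ 2 else 0) (tailSumSq lam k) := by
    refine Summable.hasSum (Summable.of_nonneg_of_le (fun i => ?_) (fun i => ?_)
      (hsum.mul_left l₁))
    · split_ifs <;> positivity
    · have h1 : lam i ^ 2 ≤ l₁ * lam i := by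
        rw [sq]; exact mul_le_mul_of_nonneg_right (hle i) (hpos i).le
      split_ifs
      · exact h1
      · exact (sq_nonneg _).trans h1
  have s4 : HasSum (fun i : Idx d => if i.1 < k then 1 / (N : ℝ) else 0) ((k : ℝ) / N) := by
    have := hasSum_ite_lt_effDim hsum hN0 hγ (1 / (N : ℝ))
    rwa [mul_one_div] at this
  -- The whole lower bound becomes one series over the eigendirections; convergence of each piece is
  -- needed since a divergent `tsum` would be `0`. The comparison is then made term by term on
  -- finite partial sums.
  have htot := (((s1.mul_left (1 / (16 * γ ^ 2 * N ^ 2))).add (s2'.mul_left (1 / 16))).add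
    (s3.mul_left (β * γ * inner ℝ u (secondMoment D u) / (128 * Real.exp 1 ^ 3)
      * min (1 / l₁) (N * γ)))).add ((s4.add (s3.mul_left (N * γ ^ 2))).mul_left ((s2 : ℝ) / 50))
  refine hasSum_le_of_sum_le htot fun F => ?_
  have hsumle : ∑ i ∈ F, lam i * sumMoment D γ wstar u (v i) N / (2 * N ^ 2)
      ≤ (∫ X, inner ℝ X.1 (secondMoment D X.1) ∂stateLaw D γ wstar u N) / (2 * N ^ 2) := by
    rw [← Finset.sum_div]
    gcongr
    exact sum_lam_mul_sumMoment_le hreg hwell heig γ u F N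
  refine le_trans (Finset.sum_le_sum fun i _ => ?_) hsumle
  have hu : 0 ≤ inner ℝ u (secondMoment D u) :=
    (hasSum_lam_mul_inner_sq hreg heig u).nonneg fun i =>
      mul_nonneg (hpos i).le (sq_nonneg _)
  have hQ := pow_mul_le_riskMoment hreg hwell heig hfourth hβ hγ.le hle hγl.le u
  have hw := v.orthonormal.1 i
  have ha0 := iterateMoment_nonneg (D := D) (wstar := wstar) γ u (v i)
  have hb0 := sumMoment_zero (D := D) (wstar := wstar) γ u (v i)
  have hc0 := crossMoment_zero (D := D) (wstar := wstar) γ u (v i)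
  have hb := sumMoment_succ hreg hwell γ u hw
  have hc := crossMoment_succ hreg hwell heig γ u i
  have ha := iterateMoment_succ_ge hreg hwell heig hfourth γ u i
  by_cases hi : i.1 < k
  · have h := head_coordinate_le hN hγ (hpos i) (hle i) hγl hβ s2.2 hu hQ ha0 hb0 hc0 hb hc ha
      ((hk_iff i).1 hi)
    rw [iterateMoment_zero] at h
    simpa [hi, not_le.2 hi] using h
  · have h := tail_coordinate_le hN hγ (hpos i) (hle i) hγl hβ s2.2 hu hQ ha0 hb0 hc0 hb hc ha
      (not_le.1 fun h => hi ((hk_iff i).2 h)).le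
    rw [iterateMoment_zero] at h
    simpa [hi, not_lt.1 hi] using h

end LowerBound

end AvgSGD

theorem theorem2p2
    {E : Type*} [NormedAddCommGroup E] [InnerProductSpace ℝ E] [CompleteSpace E]
    [SecondCountableTopology E] [MeasurableSpace E] [BorelSpace E]
    (D : Measure (E × ℝ)) [IsProbabilityMeasure D]
    (wstar : E) (s2 : ℝ≥0) (β : ℝ) (hβ : 0 ≤ β)
    (d : ℕ∞) (hd : 0 < d)
    (lam : AvgSGD.Idx d → ℝ) (v : HilbertBasis (AvgSGD.Idx d) ℝ E)
    (hreg : AvgSGD.Regularity D wstar)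
    (hwell : AvgSGD.WellSpecified D wstar s2)
    (heig : AvgSGD.IsEigendecomposition (AvgSGD.secondMoment D) lam v)
    (hfourth : AvgSGD.FourthMomentLowerBound D v β)
    (N : ℕ) (hN : 500 ≤ N)
    (γ : ℝ) (hγ : 0 < γ) (hγ' : γ < 1 / lam ⟨0, hd⟩)
    (w₀ : E)
    {Ω : Type*} [MeasurableSpace Ω] (P : Measure Ω) [IsProbabilityMeasure P]
    (Z : ℕ → Ω → E × ℝ)
    (hlaw : ∀ t < N, HasLaw (Z t) D P)
    (hindep : iIndepFun (fun t : Fin N => Z t) P) :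
    Integrable
        (fun ω => AvgSGD.risk D (AvgSGD.avgIterate γ w₀ (fun t => Z t ω) N)) P ∧
      1 / (16 * γ ^ 2 * N ^ 2)
            * AvgSGD.headNormSq lam v (AvgSGD.effDim lam N γ) (w₀ - wstar)
          + 1 / 16 * AvgSGD.tailNormSq lam v (AvgSGD.effDim lam N γ) (w₀ - wstar)
          + β * γ * inner ℝ (w₀ - wstar) (AvgSGD.secondMoment D (w₀ - wstar))
              / (128 * Real.exp 1 ^ 3)
            * min (1 / lam ⟨0, hd⟩) (N * γ)
            * AvgSGD.tailSumSq lam (AvgSGD.effDim lam N γ)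
          + s2 / 50
            * ((AvgSGD.effDim lam N γ : ℝ) / N
              + N * γ ^ 2 * AvgSGD.tailSumSq lam (AvgSGD.effDim lam N γ))
        ≤ (∫ ω, AvgSGD.risk D (AvgSGD.avgIterate γ w₀ (fun t => Z t ω) N) ∂P)
          - AvgSGD.risk D wstar := by
  obtain ⟨hint, heq⟩ := AvgSGD.integral_risk_avgIterate hreg hwell (by omega : 0 < N) γ w₀ hlaw
    hindep
  refine ⟨hint, ?_⟩
  rw [heq, add_sub_cancel_left]
  exact AvgSGD.lower_bound_le hreg hwell hβ hd heig hfourth hN hγ hγ' (w₀ - wstar)
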